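/- Let $k$ be a field complete with respect to an ultrametric absolute value $|\cdot|$ (possibly trivial). A polyradius is a finite family $r=(r_1,\dots,r_n)$ of positive real numbers. Let $k(T/r)$ be the field $k(T)=k(T_1,\dots,T_n)$ with the Gauss valuation of parameter $r$, i.e. the multiplicative extension to $k(T)$ of $\sum_I a_IT^I\mapsto \max_I |a_I|r^I$, and let $\widehat{k(T/r)}$ be its completion. A family $(v_j)_{j\in J}$ (with $J$ an arbitrary, possibly uncountable, set) of nonzero elements of a $k$-Banach space $V$ is an orthogonal Schauder basis of $V$ over $k$ if the map $(\lambda_j)\mapsto\sum_j\lambda_jv_j$ induces an isometric isomorphism onto $V$ from the completion of $\bigoplus_{j\in J}k$ for the norm $\|(\lambda_j)\|=\max_j|\lambda_j|\,\|v_j\|$. (i) For every polyradius $r$, the complete valued field $\widehat{k(T/r)}$ has an orthogonal Schauder basis over $k$. In the case of one variable ($n=1$, $r>0$ a real number) explicit orthogonal Schauder bases of $\widehat{k(T/r)}$ over $k$ are as follows. (ii) If no power $r^m$ with $m\geq 1$ belongs to $|k^\times|$, the family $(T^i)_{i\in\mathbf Z}$ is an orthogonal Schauder basis. (iii) Suppose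 that some power $r^m$ with $m\ge 1$ belongs to $|k^\times|$. Let $N$ be the least such $m$, let $c\in k$ satisfy $|c|=r^N$, and put $S=c^{-1}T^N$. Let $\mathscr P$ be any set of monic polynomials over $k^\circ=\{x\in k: |x|\le 1\}$ which reduction maps bijectively onto the set of all monic irreducible polynomials over the residue field of $k$. Then the family of all products $T^a b$, with $0\le a<N$ and $b$ running through the family $$\bigl((S^i)_{i\ge 0},\ (S^d/P(S)^m)_{P\in\mathscr P,\ 0\le d<\deg P,\ m>0}\bigr),$$ is an orthogonal Schauder basis. In particular, for $r=1$ (so $N=1$, and one may take $c=1$, $S=T$), the family $\bigl((T^i)_{i\ge 0},(T^d/P^m)_{P\in\mathscr P,\,0\le d<\deg P,\,m>0}\bigr)$ is an orthogonal Schauder basis. -/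

import Mathlib

open scoped NNReal
open UniformSpace (Completion)

universe u

noncomputable section

/-- A polyradius: a finite family of (strictly) positive real numbers. -/
abbrev Polyradius (n : ℕ) : Type := Fin n → {ρ : ℝ≥0 // 0 < ρ}

section Gauss

variable {n : ℕ} (r : Polyradius n)

/-- `r ^ t = r₁ ^ t₁ ⋯ rₙ ^ tₙ`. -/
def Polyradius.monom (r : Polyradius n) (t : Fin n →₀ ℕ) : ℝ≥0 := ∏ i, (r i : ℝ≥0) ^ t i

lemma Polyradius.monom_add (t u : Fin n →₀ ℕ) : r.monom (t + u) = r.monom t * r.monom u := by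
  simp [Polyradius.monom, pow_add, Finset.prod_mul_distrib]

lemma Polyradius.monom_pos (t : Fin n →₀ ℕ) : 0 < r.monom t :=
  Finset.prod_pos fun i _ => pow_pos (r i).2 _

variable {k : Type*} [NormedField k]

/-- The Gauss norm of parameter `r` of a polynomial: `∑ a_t T ^ t ↦ max_t |a_t| r ^ t`. -/
def gaussNNNorm (p : MvPolynomial (Fin n) k) : ℝ≥0 :=
  p.support.sup fun t => ‖p.coeff t‖₊ * r.monom t

lemma le_gaussNNNorm (p : MvPolynomial (Fin n) k) (t : Fin n →₀ ℕ) :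
    ‖p.coeff t‖₊ * r.monom t ≤ gaussNNNorm r p := by
  by_cases h : t ∈ p.support
  · exact Finset.le_sup (f := fun t => ‖p.coeff t‖₊ * r.monom t) h
  · rw [MvPolynomial.notMem_support_iff.1 h]; simp

lemma gaussNNNorm_le {p : MvPolynomial (Fin n) k} {B : ℝ≥0}
    (h : ∀ t, ‖p.coeff t‖₊ * r.monom t ≤ B) : gaussNNNorm r p ≤ B :=
  Finset.sup_le fun t _ => h t

lemma gaussNNNorm_C (a : k) : gaussNNNorm r (MvPolynomial.C a) = ‖a‖₊ := by
  classical
  refine le_antisymm (gaussNNNorm_le r fun t => ?_) ?_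
  · rw [MvPolynomial.coeff_C]
    split_ifs with h
    · subst h; simp [Polyradius.monom]
    · simp
  · simpa [Polyradius.monom] using le_gaussNNNorm r (MvPolynomial.C a) 0

lemma gaussNNNorm_eq_zero_iff (p : MvPolynomial (Fin n) k) : gaussNNNorm r p = 0 ↔ p = 0 := by
  constructor
  · intro h
    ext t
    have := le_gaussNNNorm r p t
    rw [h, nonpos_iff_eq_zero, mul_eq_zero] at this
    simpa using this.resolve_right (r.monom_pos t).ne'
  · rintro rfl; simp [gaussNNNorm]

/-- Among the exponents at which the Gauss norm is attained, there is a largest one for the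
lexicographic order. -/
lemma exists_lex_max_gaussNNNorm {p : MvPolynomial (Fin n) k} (hp : p ≠ 0) :
    ∃ t, ‖p.coeff t‖₊ * r.monom t = gaussNNNorm r p ∧
      ∀ u, toLex t < toLex u → ‖p.coeff u‖₊ * r.monom u < gaussNNNorm r p := by
  classical
  set S := p.support.filter fun t => ‖p.coeff t‖₊ * r.monom t = gaussNNNorm r p with hS
  have hne : S.Nonempty := by
    obtain ⟨t, ht, h⟩ := Finset.exists_mem_eq_sup p.support
      (MvPolynomial.support_nonempty.2 hp) fun t => ‖p.coeff t‖₊ * r.monom t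
    exact ⟨t, Finset.mem_filter.2 ⟨ht, h.symm⟩⟩
  obtain ⟨t, ht, hmax⟩ := Finset.exists_max_image S toLex hne
  refine ⟨t, (Finset.mem_filter.1 ht).2, fun u hu => ?_⟩
  refine lt_of_le_of_ne (le_gaussNNNorm r p u) fun h => ?_
  have hu' : u ∈ S := by
    refine Finset.mem_filter.2 ⟨?_, h⟩
    rw [MvPolynomial.mem_support_iff]
    intro h0
    rw [h0] at h
    simp only [nnnorm_zero, zero_mul] at h
    exact hp ((gaussNNNorm_eq_zero_iff r p).1 h.symm)
  exact absurd (hmax u hu') (not_le.2 hu)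

variable [IsUltrametricDist k]

lemma gaussNNNorm_add_le (p q : MvPolynomial (Fin n) k) :
    gaussNNNorm r (p + q) ≤ max (gaussNNNorm r p) (gaussNNNorm r q) := by
  refine gaussNNNorm_le r fun t => ?_
  rw [MvPolynomial.coeff_add]
  calc ‖p.coeff t + q.coeff t‖₊ * r.monom t
      ≤ max ‖p.coeff t‖₊ ‖q.coeff t‖₊ * r.monom t := by
        gcongr
        exact IsUltrametricDist.nnnorm_add_le_max _ _
    _ = max (‖p.coeff t‖₊ * r.monom t) (‖q.coeff t‖₊ * r.monom t) :=
        max_mul_of_nonneg _ _ zero_le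
    _ ≤ _ := max_le_max (le_gaussNNNorm r p t) (le_gaussNNNorm r q t)

lemma gaussNNNorm_mul (p q : MvPolynomial (Fin n) k) :
    gaussNNNorm r (p * q) = gaussNNNorm r p * gaussNNNorm r q := by
  classical
  have key : ∀ a b : Fin n →₀ ℕ, ‖p.coeff a * q.coeff b‖₊ * r.monom (a + b) =
      (‖p.coeff a‖₊ * r.monom a) * (‖q.coeff b‖₊ * r.monom b) := fun a b => by
    rw [nnnorm_mul, r.monom_add]; ring
  apply le_antisymm
  · refine gaussNNNorm_le r fun t => ?_
    rw [MvPolynomial.coeff_mul]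
    rw [← le_div_iff₀ (r.monom_pos t)]
    refine IsUltrametricDist.nnnorm_sum_le_of_forall_le fun x hx => ?_
    rw [le_div_iff₀ (r.monom_pos t), ← Finset.HasAntidiagonal.mem_antidiagonal.1 hx, key]
    exact mul_le_mul' (le_gaussNNNorm r p _) (le_gaussNNNorm r q _)
  · by_cases hp : p = 0
    · simp [hp, gaussNNNorm]
    by_cases hq : q = 0
    · simp [hq, gaussNNNorm]
    obtain ⟨a, ha, ha'⟩ := exists_lex_max_gaussNNNorm r hp
    obtain ⟨b, hb, hb'⟩ := exists_lex_max_gaussNNNorm r hq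
    have hp0 : 0 < gaussNNNorm r p := pos_iff_ne_zero.2 (by rwa [Ne, gaussNNNorm_eq_zero_iff])
    have hq0 : 0 < gaussNNNorm r q := pos_iff_ne_zero.2 (by rwa [Ne, gaussNNNorm_eq_zero_iff])
    have hdom : ∀ x ∈ Finset.HasAntidiagonal.antidiagonal (a + b), x ≠ (a, b) →
        ‖p.coeff x.1 * q.coeff x.2‖ < ‖p.coeff a * q.coeff b‖ := by
      rintro ⟨c, d⟩ hx hne
      have hcd : c + d = a + b := Finset.HasAntidiagonal.mem_antidiagonal.1 hx
      have hlt : (‖p.coeff c‖₊ * r.monom c) * (‖q.coeff d‖₊ * r.monom d) <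
          gaussNNNorm r p * gaussNNNorm r q := by
        rcases lt_trichotomy (toLex a) (toLex c) with h | h | h
        · exact mul_lt_mul_of_lt_of_le_of_nonneg_of_pos (ha' c h) (le_gaussNNNorm r q d)
            zero_le hq0
        · have h1 : a = c := toLex.injective h
          subst h1
          exact absurd (by rw [add_left_cancel hcd]) hne
        · have hbd : toLex b < toLex d := by
            by_contra hle
            have h2 : toLex c + toLex d < toLex a + toLex b :=
              add_lt_add_of_lt_of_le h (not_lt.1 hle)
            exact h2.ne (congrArg toLex hcd)
          exact mul_lt_mul_of_le_of_lt_of_nonneg_of_pos (le_gaussNNNorm r p c) (hb' d hbd)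
            zero_le hp0
      rw [← ha, ← hb, ← key, ← key, show c + d = a + b from hcd] at hlt
      exact_mod_cast lt_of_mul_lt_mul_right' hlt
    have hcoeff : ‖(p * q).coeff (a + b)‖₊ = ‖p.coeff a * q.coeff b‖₊ := by
      rw [MvPolynomial.coeff_mul]
      exact NNReal.eq (IsNonarchimedean.apply_sum_eq_of_lt
        (f := fun x : k => ‖x‖) IsUltrametricDist.isNonarchimedean_norm
        (fun a => (norm_neg a).symm) (k := (a, b))
        (s := Finset.HasAntidiagonal.antidiagonal (a + b))
        (Finset.HasAntidiagonal.mem_antidiagonal.2 rfl) hdom)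
    calc _ = ‖(p * q).coeff (a + b)‖₊ * r.monom (a + b) := by rw [hcoeff, key, ha, hb]
      _ ≤ _ := le_gaussNNNorm r _ _

end Gauss

section GaussField

variable (k : Type*) [NormedField k] [IsUltrametricDist k] {n : ℕ} (r : Polyradius n)

/-- The Gauss norm as a (multiplicative) valuation on `k[T₁, …, Tₙ]`. -/
def gaussValuation : Valuation (MvPolynomial (Fin n) k) ℝ≥0 where
  toFun := gaussNNNorm r
  map_zero' := (gaussNNNorm_eq_zero_iff r _).2 rfl
  map_one' := by rw [← MvPolynomial.C_1, gaussNNNorm_C, nnnorm_one]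
  map_mul' := gaussNNNorm_mul r
  map_add_le_max' := gaussNNNorm_add_le r

lemma nonZeroDivisors_le_gaussValuation :
    nonZeroDivisors (MvPolynomial (Fin n) k) ≤ (gaussValuation k r).supp.primeCompl := by
  intro p hp h
  exact nonZeroDivisors.ne_zero hp ((gaussNNNorm_eq_zero_iff r p).1 h)

/-- The field `k(T₁, …, Tₙ)`, to be equipped with the Gauss valuation of parameter `r`. -/
def GaussField (_r : Polyradius n) : Type _ := FractionRing (MvPolynomial (Fin n) k)

namespace GaussField

instance : Field (GaussField k r) :=
  inferInstanceAs (Field (FractionRing (MvPolynomial (Fin n) k)))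

instance : Algebra (MvPolynomial (Fin n) k) (GaussField k r) :=
  inferInstanceAs (Algebra _ (FractionRing (MvPolynomial (Fin n) k)))

instance : IsFractionRing (MvPolynomial (Fin n) k) (GaussField k r) :=
  inferInstanceAs (IsFractionRing _ (FractionRing (MvPolynomial (Fin n) k)))

instance : Algebra k (GaussField k r) :=
  inferInstanceAs (Algebra k (FractionRing (MvPolynomial (Fin n) k)))

instance : IsScalarTower k (MvPolynomial (Fin n) k) (GaussField k r) :=
  inferInstanceAs (IsScalarTower k _ (FractionRing (MvPolynomial (Fin n) k)))

/-- The Gauss valuation of parameter `r` on `k(T₁, …, Tₙ)`. -/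
def valuation : Valuation (GaussField k r) ℝ≥0 :=
  (gaussValuation k r).extendToLocalization (nonZeroDivisors_le_gaussValuation k r) _

/-- The Gauss valuation of parameter `r` on `k(T₁, …, Tₙ)`, as a real absolute value. -/
def absoluteValue : AbsoluteValue (GaussField k r) ℝ where
  toFun x := valuation k r x
  map_mul' x y := by rw [map_mul, NNReal.coe_mul]
  nonneg' x := NNReal.coe_nonneg _
  eq_zero' x := by rw [NNReal.coe_eq_zero, map_eq_zero]
  add_le' x y := by
    rw [← NNReal.coe_add, NNReal.coe_le_coe]
    exact ((valuation k r).map_add x y).trans (max_le_add_of_nonneg zero_le zero_le)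

/-- `k(T / r)`: the field `k(T₁, …, Tₙ)` normed by the Gauss valuation of parameter `r`. -/
instance : NormedField (GaussField k r) := (absoluteValue k r).toNormedField

lemma norm_def (x : GaussField k r) : ‖x‖ = valuation k r x := rfl

lemma norm_algebraMap_polynomial (p : MvPolynomial (Fin n) k) :
    ‖algebraMap (MvPolynomial (Fin n) k) (GaussField k r) p‖ = gaussNNNorm r p := by
  rw [norm_def, valuation, Valuation.extendToLocalization_apply_map_apply]
  rfl

lemma norm_div (p q : MvPolynomial (Fin n) k) :
    ‖algebraMap (MvPolynomial (Fin n) k) (GaussField k r) p / algebraMap _ _ q‖ =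
      gaussNNNorm r p / gaussNNNorm r q := by
  rw [_root_.norm_div, norm_algebraMap_polynomial, norm_algebraMap_polynomial]

lemma norm_algebraMap_field (a : k) : ‖algebraMap k (GaussField k r) a‖ = ‖a‖ := by
  rw [IsScalarTower.algebraMap_apply k (MvPolynomial (Fin n) k) (GaussField k r),
    norm_algebraMap_polynomial, MvPolynomial.algebraMap_eq, gaussNNNorm_C, coe_nnnorm]

instance : NormedAlgebra k (GaussField k r) where
  norm_smul_le a x := by rw [Algebra.smul_def, norm_mul, norm_algebraMap_field]

instance : IsUltrametricDist (GaussField k r) :=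
  IsUltrametricDist.isUltrametricDist_of_forall_norm_add_le_max_norm fun x y => by
    simp only [norm_def]
    exact_mod_cast (valuation k r).map_add x y

variable {k}

/-- The indeterminate `T_i`, as an element of `k(T / r)`. -/
def T (i : Fin n) : GaussField k r := algebraMap (MvPolynomial (Fin n) k) _ (MvPolynomial.X i)

end GaussField

end GaussField

section Schauder

/-- The underlying space of the direct sum `⨁ j, k(w j)`, to be normed with the weights `w`. -/
def WeightedSum (k : Type*) [NormedField k] {J : Type*} (_w : J → ℝ≥0) : Type _ := J →₀ k

namespace WeightedSum

variable {k : Type*} [NormedField k] {J : Type*} {w : J → ℝ≥0}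

instance : AddCommGroup (WeightedSum k w) := inferInstanceAs (AddCommGroup (J →₀ k))

instance : Module k (WeightedSum k w) := inferInstanceAs (Module k (J →₀ k))

/-- A finitely supported family of scalars, as an element of the direct sum. -/
def ofFinsupp (w : J → ℝ≥0) : (J →₀ k) ≃ₗ[k] WeightedSum k w := LinearEquiv.refl k (J →₀ k)

/-- The family of scalars underlying an element of the direct sum. -/
def coeffs (c : WeightedSum k w) : J →₀ k := (ofFinsupp w).symm c

/-- The norm `‖(λ_j)‖ = max_j |λ_j| w_j`. -/
protected def nnnorm (c : WeightedSum k w) : ℝ≥0 :=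
  c.coeffs.support.sup fun j => ‖c.coeffs j‖₊ * w j

lemma le_nnnorm (c : WeightedSum k w) (j : J) :
    ‖c.coeffs j‖₊ * w j ≤ c.nnnorm := by
  by_cases h : j ∈ c.coeffs.support
  · exact Finset.le_sup (f := fun j => ‖c.coeffs j‖₊ * w j) h
  · rw [Finsupp.notMem_support_iff] at h
    simp [h]

lemma nnnorm_le {c : WeightedSum k w} {B : ℝ≥0}
    (h : ∀ j, ‖c.coeffs j‖₊ * w j ≤ B) : c.nnnorm ≤ B :=
  Finset.sup_le fun j _ => h j

instance : SeminormedAddCommGroup (WeightedSum k w) :=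
  AddGroupSeminorm.toSeminormedAddCommGroup
    { toFun := fun c => (c.nnnorm : ℝ)
      map_zero' := by
        rw [NNReal.coe_eq_zero]
        exact nonpos_iff_eq_zero.1 (nnnorm_le fun j => by
          rw [show (0 : WeightedSum k w).coeffs j = 0 from rfl]; simp)
      add_le' := fun c d => by
        rw [← NNReal.coe_add, NNReal.coe_le_coe]
        refine nnnorm_le fun j => ?_
        calc ‖c.coeffs j + d.coeffs j‖₊ * w j
            ≤ (‖c.coeffs j‖₊ + ‖d.coeffs j‖₊) * w j := by
              gcongr; exact nnnorm_add_le _ _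
          _ ≤ _ := by rw [add_mul]; exact add_le_add (le_nnnorm c j) (le_nnnorm d j)
      neg' := fun c => by
        have h : ∀ c : WeightedSum k w, (-c).nnnorm ≤ c.nnnorm := fun c => nnnorm_le fun j => by
          rw [show (-c).coeffs j = -c.coeffs j from rfl, nnnorm_neg]
          exact le_nnnorm c j
        exact congrArg _ (le_antisymm (h c) (by simpa using h (-c))) }

lemma norm_def (c : WeightedSum k w) : ‖c‖ = c.nnnorm := rfl

instance : NormedSpace k (WeightedSum k w) where
  norm_smul_le a c := by
    rw [norm_def, norm_def, ← coe_nnnorm a, ← NNReal.coe_mul, NNReal.coe_le_coe]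
    refine nnnorm_le fun j => ?_
    rw [show (a • c).coeffs j = a * c.coeffs j from rfl, nnnorm_mul,
      mul_assoc]
    gcongr
    exact le_nnnorm c j

end WeightedSum

/-- A family `v` of nonzero elements of the `k`-Banach space `V` is an orthogonal Schauder basis
if `(λ_j) ↦ ∑ λ_j v_j` induces an isometric isomorphism from the completion of the direct sum
`⨁ j, k(‖v j‖)` onto `V`. -/
def IsOrthogonalSchauderBasis (k : Type*) [NormedField k] {V : Type*} [NormedAddCommGroup V]
    [NormedSpace k V] {J : Type*} (v : J → V) : Prop :=
  (∀ j, v j ≠ 0) ∧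
    ∃ Φ : Completion (WeightedSum k fun j => ‖v j‖₊) ≃ₗᵢ[k] V,
      ∀ c : J →₀ k,
        Φ (WeightedSum.ofFinsupp (fun j => ‖v j‖₊) c) = c.sum fun j a => a • v j

end Schauder

section Explicit

variable (k : Type*) [NormedField k] [IsUltrametricDist k]

/-- The ring of integers `k° = {x | |x| ≤ 1}`. -/
abbrev integerRing : ValuationSubring k := (NormedField.valuation (K := k)).valuationSubring

variable {k}

/-- `Ps` is a set of monic polynomials over `k°` which reduction maps bijectively onto the set of
all monic irreducible polynomials over the residue field of `k`. -/
def IsIrreducibleLift (Ps : Set (Polynomial (integerRing k))) : Prop :=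
  (∀ P ∈ Ps, P.Monic) ∧
    Set.BijOn (Polynomial.map (IsLocalRing.residue (integerRing k))) Ps
      {Q | Q.Monic ∧ Irreducible Q}

/-- For `S` in a field extension `L` of `k`: the elements `S ^ i` for `i ≥ 0`, and
`S ^ d / P(S) ^ m` for `P ∈ Ps`, `0 ≤ d < deg P`, `m > 0` (with `m` written `m' + 1`). -/
def partialFractionFamily {L : Type*} [Field L] [Algebra k L]
    (Ps : Set (Polynomial (integerRing k))) (S : L) :
    ℕ ⊕ (Σ P : Ps, Fin P.1.natDegree × ℕ) → L
  | .inl i => S ^ i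
  | .inr ⟨P, d, m⟩ =>
      S ^ (d : ℕ) / (Polynomial.aeval S (P.1.map (algebraMap (integerRing k) k))) ^ (m + 1)

end Explicit

end

/-! All estimates are made in the uncompleted field `k(T/r)`. There a family of nonzero vectors is
shown to be norm-orthogonal (no cancellation in finite combinations) and to have dense span. The map
from the weighted direct sum is then a linear isometry with dense range, and it extends to an
isometric isomorphism of completions (`IsOrthogonalTotal.isOrthogonalSchauderBasis`).

One variable, no positive power of `r` in `|k^×|`: the terms of a Laurent polynomial have distinct
norms. This gives orthogonality. It also makes every nonzero polynomial a dominant monomial plus a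
smaller error, so its inverse is a limit of Laurent polynomials by the geometric series.

One variable, `r ^ N = |c|` with `N` minimal: the powers of `S = c⁻¹ T ^ N` are orthonormal, so an
integral polynomial in `S` has norm `< 1` exactly when its reduction vanishes. Orthogonality of the
partial fractions becomes independence of partial fractions over the residue field, checked one
prime at a time on the pole of highest order. For density, the span of the family is stable under
multiplication by `S` and by each `P(S)⁻¹`. Factoring the reduction of a polynomial gives a product
of elements of this algebra with the same reduction, and the geometric series again yields the
inverse. The factors `T ^ a`, `0 ≤ a < N`, have norms in distinct classes modulo `|k^×|` and
generate `k(T)` over `k(S)`.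

Several variables: `k(T/r)` is a one-variable Gauss extension of the field in the remaining
variables, and orthogonal total families multiply in towers (`IsOrthogonalTotal.tower`). The
intermediate field need not be complete, which is why completion is left to the end. -/

noncomputable section

/-! ### Orthogonal families, towers and passage to the completion. -/

section Orthogonality

/-- A family `v` of vectors is norm-orthogonal over `k` if the norm of each term of a finite
linear combination is bounded by the norm of the combination. -/
def IsNormOrthogonal (k : Type*) [NormedField k] {X : Type*} [SeminormedAddCommGroup X]
    [Module k X] {J : Type*} (v : J → X) : Prop :=
  ∀ (s : Finset J) (c : J → k), ∀ j ∈ s, ‖c j‖ * ‖v j‖ ≤ ‖∑ i ∈ s, c i • v i‖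

/-- A norm-orthogonal family of nonzero vectors spanning a dense subspace. -/
structure IsOrthogonalTotal (k : Type*) [NormedField k] {X : Type*} [NormedAddCommGroup X]
    [NormedSpace k X] {J : Type*} (v : J → X) : Prop where
  ne_zero : ∀ j, v j ≠ 0
  orthogonal : IsNormOrthogonal k v
  dense : Dense (Submodule.span k (Set.range v) : Set X)

/-- If nonzero terms of a finite sum have pairwise distinct norms, then each term is bounded by
the sum. -/
lemma norm_le_norm_sum_of_norm_injOn {X J : Type*} [NormedAddCommGroup X] [IsUltrametricDist X]
    {s : Finset J} {x : J → X}
    (h : ∀ i ∈ s, ∀ j ∈ s, i ≠ j → ‖x i‖ = ‖x j‖ → x i = 0) {j : J} (hj : j ∈ s) :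
    ‖x j‖ ≤ ‖∑ i ∈ s, x i‖ := by
  obtain ⟨m, hm, hmax⟩ := Finset.exists_max_image s (fun i => ‖x i‖) ⟨j, hj⟩
  by_cases h0 : x m = 0
  · refine (hmax j hj).trans ?_
    simp [h0]
  refine (hmax j hj).trans (le_of_eq ?_)
  -- A nonzero term of maximal norm is strictly larger than all the others, so the sum has the same
  -- norm.
  refine (IsNonarchimedean.apply_sum_eq_of_lt (f := fun x : X => ‖x‖)
    IsUltrametricDist.isNonarchimedean_norm (fun a => (norm_neg a).symm) hm
    fun i hi him => lt_of_le_of_ne (hmax i hi) fun he => h0 ?_).symm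
  exact h m hm i hi him.symm he.symm

namespace IsNormOrthogonal

variable {k : Type*} [NormedField k] {X : Type*} [NormedAddCommGroup X] [NormedSpace k X]
  {J : Type*} {v : J → X}

lemma comp_injective (hv : IsNormOrthogonal k v) {I : Type*} {f : I → J}
    (hf : Function.Injective f) : IsNormOrthogonal k fun i => v (f i) := by
  classical
  intro s c i hi
  have := hv (s.map ⟨f, hf⟩) (Function.extend f c 0) (f i) (Finset.mem_map_of_mem ⟨f, hf⟩ hi)
  simpa [Finset.sum_map, hf.extend_apply] using this

lemma smul (hv : IsNormOrthogonal k v) (u : J → k) : IsNormOrthogonal k fun j => u j • v j := by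
  intro s c j hj
  have := hv s (fun j => c j * u j) j hj
  simpa [mul_smul, norm_smul, mul_assoc] using this

lemma of_norm_injective [IsUltrametricDist X]
    (h : ∀ i j, i ≠ j → ∀ a b : k, ‖a‖ * ‖v i‖ = ‖b‖ * ‖v j‖ → a = 0) :
    IsNormOrthogonal k v := by
  intro s c j hj
  rw [← norm_smul]
  refine norm_le_norm_sum_of_norm_injOn (x := fun i => c i • v i) (fun i _ l _ hil he => ?_) hj
  rw [norm_smul, norm_smul] at he
  rw [h i l hil _ _ he, zero_smul]

/-- For families indexed by a product, it suffices to consider sums over rectangles. -/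
lemma of_prod {I : Type*} {v : I × J → X}
    (h : ∀ (s : Finset I) (t : Finset J) (c : I × J → k), ∀ i ∈ s, ∀ j ∈ t,
      ‖c (i, j)‖ * ‖v (i, j)‖ ≤ ‖∑ i ∈ s, ∑ j ∈ t, c (i, j) • v (i, j)‖) :
    IsNormOrthogonal k v := by
  classical
  rintro s c ⟨i, j⟩ hij
  -- Any finite set of indices lies in the rectangle on its projections; the coefficients are padded
  -- with `0`.
  have hsub : s ⊆ s.image Prod.fst ×ˢ s.image Prod.snd := Finset.subset_product
  have := h (s.image Prod.fst) (s.image Prod.snd) (fun x => if x ∈ s then c x else 0) i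
    (Finset.mem_image_of_mem Prod.fst hij) j (Finset.mem_image_of_mem Prod.snd hij)
  rw [← Finset.sum_product', ← Finset.sum_subset hsub fun x _ hx => by simp [hx]] at this
  rw [if_pos hij] at this
  refine this.trans (le_of_eq (congrArg _ (Finset.sum_congr rfl fun x hx => ?_)))
  simp [hx]

/-- In an ultrametric space, norms of combinations of an orthogonal family are maxima. -/
lemma exists_norm_sum_eq [IsUltrametricDist X] (hv : IsNormOrthogonal k v) {s : Finset J}
    (hs : s.Nonempty) (c : J → k) :
    ∃ j ∈ s, ‖∑ i ∈ s, c i • v i‖ = ‖c j‖ * ‖v j‖ := by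
  obtain ⟨m, hm, hmax⟩ := Finset.exists_max_image s (fun i => ‖c i‖ * ‖v i‖) hs
  refine ⟨m, hm, le_antisymm ?_ (hv s c m hm)⟩
  refine IsUltrametricDist.norm_sum_le_of_forall_le_of_nonneg (by positivity) fun i hi => ?_
  rw [norm_smul]
  exact hmax i hi

end IsNormOrthogonal

lemma IsOrthogonalTotal.comp_equiv {k : Type*} [NormedField k] {X : Type*} [NormedAddCommGroup X]
    [NormedSpace k X] {I J : Type*} {v : J → X} (hv : IsOrthogonalTotal k v) (e : I ≃ J) :
    IsOrthogonalTotal k fun i => v (e i) where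
  ne_zero i := hv.ne_zero (e i)
  orthogonal := hv.orthogonal.comp_injective e.injective
  dense := by
    have : Set.range (fun i => v (e i)) = Set.range v := e.surjective.range_comp v
    rw [this]
    exact hv.dense

/-- Products of orthogonal total families in a tower of normed fields. -/
lemma IsOrthogonalTotal.tower {k F L : Type*} [NormedField k] [NormedField F] [NormedField L]
    [NormedAlgebra k F] [NormedAlgebra F L] [NormedAlgebra k L] [IsScalarTower k F L]
    {I J : Type*} {v : I → F} {w : J → L}
    (hv : IsOrthogonalTotal k v) (hw : IsOrthogonalTotal F w) :
    IsOrthogonalTotal k fun p : J × I => v p.2 • w p.1 where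
  ne_zero p := smul_ne_zero (hv.ne_zero _) (hw.ne_zero _)
  orthogonal := by
    refine IsNormOrthogonal.of_prod fun s t c j hj i hi => ?_
    -- Orthogonality is used twice: over `F`, with the inner sums as coefficients, and then over `k`
    -- inside one such coefficient.
    have h1 := hw.orthogonal s (fun j => ∑ i ∈ t, c (j, i) • v i) j hj
    have h2 := hv.orthogonal t (fun i => c (j, i)) i hi
    simp only [Finset.sum_smul, smul_assoc] at h1
    rw [norm_smul, ← mul_assoc]
    exact (mul_le_mul_of_nonneg_right h2 (norm_nonneg _)).trans h1
  dense := by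
    set D := (Submodule.span k (Set.range fun p : J × I => v p.2 • w p.1)).topologicalClosure
      with hD
    have hDcl : IsClosed (D : Set L) := Submodule.isClosed_topologicalClosure _
    have key : ∀ (x : F) (j : J), x • w j ∈ D := by
      intro x j
      have hcl : IsClosed {x : F | x • w j ∈ D} :=
        hDcl.preimage (continuous_id.smul continuous_const)
      have hsub : (Submodule.span k (Set.range v) : Set F) ⊆ {x : F | x • w j ∈ D} := by
        intro x hx
        induction hx using Submodule.span_induction with
        | mem x hx =>
          obtain ⟨i, rfl⟩ := hx
          exact Submodule.le_topologicalClosure _ (Submodule.subset_span ⟨(j, i), rfl⟩)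
        | zero => simp
        | add x y _ _ hx hy =>
          simp only [Set.mem_ofPred_eq, add_smul] at *
          exact D.add_mem hx hy
        | smul a x _ hx =>
          simp only [Set.mem_ofPred_eq, smul_assoc] at *
          exact D.smul_mem a hx
      have := closure_minimal hsub hcl
      rw [hv.dense.closure_eq] at this
      exact this (Set.mem_univ x)
    have hmem : ∀ x ∈ Submodule.span F (Set.range w), ∀ a : F, a • x ∈ D := by
      intro x hx
      induction hx using Submodule.span_induction with
      | mem x hx =>
        obtain ⟨j, rfl⟩ := hx
        exact fun a => key a j
      | zero => simp
      | add x y _ _ hx hy =>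
        intro a
        rw [smul_add]
        exact D.add_mem (hx a) (hy a)
      | smul b x _ hx =>
        intro a
        rw [smul_smul]
        exact hx _
    have hsub : (Submodule.span F (Set.range w) : Set L) ⊆ D := fun x hx => by
      simpa using hmem x hx 1
    have := closure_minimal hsub hDcl
    rw [hw.dense.closure_eq] at this
    intro x
    exact this (Set.mem_univ x)

/-- A linear isometry with dense range into a complete space extends to the completion of its
source as an isometric isomorphism. -/
lemma exists_completion_linearIsometryEquiv {k E Y : Type*} [NormedField k]
    [SeminormedAddCommGroup E] [NormedSpace k E] [NormedAddCommGroup Y] [NormedSpace k Y]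
    [CompleteSpace Y] (f : E →ₗᵢ[k] Y) (hf : DenseRange f) :
    ∃ Φ : Completion E ≃ₗᵢ[k] Y, ∀ x : E, Φ x = f x := by
  let e : E →L[k] Completion E := Completion.toComplL
  let g : Completion E →L[k] Y := f.toContinuousLinearMap.extend e
  have hg : ∀ x : E, g x = f x := fun x =>
    ContinuousLinearMap.extend_eq f.toContinuousLinearMap (e := e) Completion.denseRange_coe
      (Completion.isUniformInducing_coe _) x
  have hgn : ∀ x, ‖g x‖ = ‖x‖ := by
    intro x
    induction x using Completion.induction_on with
    | hp => exact isClosed_eq g.continuous.norm continuous_norm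
    | ih c => rw [hg, f.norm_map, Completion.norm_coe]
  let G : Completion E →ₗᵢ[k] Y := ⟨g.toLinearMap, hgn⟩
  have hG : ∀ x : E, G x = f x := hg
  have hsurj : Function.Surjective G := by
    -- The isometric image of a complete space is closed, so a dense image is everything.
    have hcl : IsClosed (Set.range G) := G.isometry.isClosedEmbedding.isClosed_range
    have hd : Dense (Set.range G) := Dense.mono (by
      rintro _ ⟨x, rfl⟩
      exact ⟨x, hG x⟩) hf
    intro x
    have := hd x
    rwa [hcl.closure_eq] at this
  exact ⟨LinearIsometryEquiv.ofSurjective G hsurj, hG⟩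

/-- The linear isometry from a weighted direct sum given by an orthogonal family. -/
def IsNormOrthogonal.linearIsometry {k : Type*} [NormedField k] {X : Type*}
    [NormedAddCommGroup X] [NormedSpace k X] [IsUltrametricDist X] {J : Type*} {v : J → X}
    (hv : IsNormOrthogonal k v) {w : J → ℝ≥0} (hw : ∀ j, w j = ‖v j‖₊) :
    WeightedSum k w →ₗᵢ[k] X where
  toLinearMap := Finsupp.linearCombination k v ∘ₗ (WeightedSum.ofFinsupp w).symm.toLinearMap
  norm_map' c := by
    change ‖∑ j ∈ c.coeffs.support, c.coeffs j • v j‖ = _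
    rw [WeightedSum.norm_def]
    apply le_antisymm
    · refine IsUltrametricDist.norm_sum_le_of_forall_le_of_nonneg (NNReal.coe_nonneg _)
        fun j _ => ?_
      rw [norm_smul]
      have := WeightedSum.le_nnnorm c j
      rw [hw] at this
      exact_mod_cast this
    · rw [← coe_nnnorm, NNReal.coe_le_coe]
      refine Finset.sup_le fun j hj => ?_
      rw [hw]
      exact_mod_cast hv _ _ j hj

/-- An orthogonal total family of a normed space is an orthogonal Schauder basis of its
completion. -/
theorem IsOrthogonalTotal.isOrthogonalSchauderBasis {k : Type*} [NormedField k] {X : Type*}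
    [NormedAddCommGroup X] [NormedSpace k X] [IsUltrametricDist X] {J : Type*} {v : J → X}
    (hv : IsOrthogonalTotal k v) :
    IsOrthogonalSchauderBasis k fun j => (v j : Completion X) := by
  refine ⟨fun j => by simpa using hv.ne_zero j, ?_⟩
  -- The weights in the definition are norms taken in the completion; `linearIsometry` leaves `w`
  -- free to allow for this.
  have hwj : ∀ j, ‖(v j : Completion X)‖₊ = ‖v j‖₊ := fun j => NNReal.eq (by simp)
  let f := (Completion.toComplₗᵢ (𝕜 := k) (E := X)).comp (hv.orthogonal.linearIsometry hwj)
  have hf : ∀ c : J →₀ k, f (WeightedSum.ofFinsupp _ c) =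
      ((Finsupp.linearCombination k v c : X) : Completion X) := fun c => rfl
  have hdense : DenseRange f := by
    have hd' : Dense ((fun x : X => (x : Completion X)) ''
        (Submodule.span k (Set.range v) : Set X)) :=
      Completion.denseRange_coe.dense_image (Completion.continuous_coe X) hv.dense
    refine hd'.mono ?_
    rintro _ ⟨x, hx, rfl⟩
    obtain ⟨c, rfl⟩ := (Finsupp.mem_span_range_iff_exists_finsupp).1 hx
    exact ⟨WeightedSum.ofFinsupp _ c, hf c⟩
  obtain ⟨Φ, hΦ⟩ := exists_completion_linearIsometryEquiv f hdense
  refine ⟨Φ, fun c => (hΦ _).trans ((hf c).trans ?_)⟩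
  change Completion.toComplₗᵢ (𝕜 := k) (E := X) (Finsupp.linearCombination k v c) = _
  rw [Finsupp.linearCombination_apply, Finsupp.sum, map_sum]
  simp [Finsupp.sum]

end Orthogonality
-- Approximating inverses, and the monomial basis.
section OneVariable

open Polynomial

variable {k L : Type*} [NormedField k] [NormedField L]

/-- If no scalar has norm `‖T‖ ^ |i - j|`, then nonzero scalar multiples of `T ^ i` and `T ^ j`
have distinct norms. -/
lemma eq_zero_of_norm_mul_zpow_eq {T : L} (hT : T ≠ 0) {i j : ℤ}
    (h : ∀ a : k, ‖a‖ ≠ ‖T‖ ^ (i - j).natAbs) {a b : k}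
    (hab : ‖a‖ * ‖T ^ i‖ = ‖b‖ * ‖T ^ j‖) : a = 0 := by
  have hT0 : ‖T‖ ≠ 0 := norm_ne_zero_iff.2 hT
  by_contra ha
  have ha0 : ‖a‖ ≠ 0 := norm_ne_zero_iff.2 ha
  rw [norm_zpow, norm_zpow] at hab
  have hb0 : ‖b‖ ≠ 0 := fun hb => by
    rw [hb, zero_mul] at hab
    exact (mul_ne_zero ha0 (zpow_ne_zero i hT0)) hab
  -- One of the ratios `a / b`, `b / a` has norm `‖T‖ ^ |i - j|`, which is excluded.
  rcases le_total i j with hle | hle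
  · refine h (a / b) ?_
    rw [norm_div, ← zpow_natCast, Int.ofNat_natAbs_of_nonpos (sub_nonpos.2 hle), neg_sub,
      zpow_sub₀ hT0, div_eq_div_iff hb0 (zpow_ne_zero i hT0), hab, mul_comm]
  · refine h (b / a) ?_
    rw [norm_div, ← zpow_natCast, Int.natAbs_of_nonneg (sub_nonneg.2 hle), zpow_sub₀ hT0,
      div_eq_div_iff ha0 (zpow_ne_zero j hT0), ← hab, mul_comm]

variable [NormedAlgebra k L]

lemma norm_sub_le_max_norm [IsUltrametricDist L] (x y : L) : ‖x - y‖ ≤ max ‖x‖ ‖y‖ := by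
  rw [sub_eq_add_neg, ← norm_neg y]
  exact IsUltrametricDist.norm_add_le_max _ _

lemma norm_sum_lt_of_forall_lt [IsUltrametricDist L] {ι : Type*} {s : Finset ι} {f : ι → L}
    {C : ℝ} (hC : 0 < C) (h : ∀ i ∈ s, ‖f i‖ < C) : ‖∑ i ∈ s, f i‖ < C :=
  Finset.sum_induction f (fun x => ‖x‖ < C)
    (fun x y hx hy => (IsUltrametricDist.norm_add_le_max x y).trans_lt (max_lt hx hy))
    (by simpa using hC) h

/-- If `g` is close to an invertible element of a subalgebra, then `g⁻¹` is in its closure. -/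
lemma inv_mem_topologicalClosure {A : Subalgebra k L} {g x : L} (hg : g ∈ A) (hx : x⁻¹ ∈ A)
    (h : ‖g - x‖ < ‖x‖) : g⁻¹ ∈ A.topologicalClosure := by
  have hx0 : x ≠ 0 := by
    rintro rfl
    simp at h
    exact absurd h (not_lt.2 (norm_nonneg _))
  have hy : ‖1 - g * x⁻¹‖ < 1 := by
    have : 1 - g * x⁻¹ = -((g - x) * x⁻¹) := by
      field_simp
      ring
    rw [this, norm_neg, norm_mul, norm_inv, ← div_eq_mul_inv]
    exact (div_lt_one (norm_pos_iff.2 hx0)).2 h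
  have hyA : 1 - g * x⁻¹ ∈ A := A.sub_mem A.one_mem (A.mul_mem hg hx)
  -- The geometric series has its sum already in the field `L`, so completeness is not needed.
  have hz : (1 - (1 - g * x⁻¹))⁻¹ ∈ A.topologicalClosure :=
    mem_closure_of_tendsto (hasSum_geometric_of_norm_lt_one hy)
      (Filter.Eventually.of_forall fun s => A.sum_mem fun i _ => A.pow_mem hyA i)
  have : g⁻¹ = x⁻¹ * (1 - (1 - g * x⁻¹))⁻¹ := by
    rw [sub_sub_cancel, mul_inv, inv_inv]
    field_simp
  rw [this]
  exact A.topologicalClosure.mul_mem (A.le_topologicalClosure hx) hz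

/-- A span containing `1` and stable under multiplication by generators contains the algebra
they generate. -/
lemma adjoin_subset_span {ι : Type*} {v : ι → L} {X : Set L}
    (h1 : (1 : L) ∈ Submodule.span k (Set.range v))
    (h : ∀ x ∈ X, ∀ i, x * v i ∈ Submodule.span k (Set.range v)) :
    (Algebra.adjoin k X : Set L) ⊆ Submodule.span k (Set.range v) := by
  have key : ∀ a ∈ Algebra.adjoin k X, ∀ w ∈ Submodule.span k (Set.range v),
      a * w ∈ Submodule.span k (Set.range v) := by
    intro a ha
    induction ha using Algebra.adjoin_induction with
    | mem x hx =>
      intro w hw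
      induction hw using Submodule.span_induction with
      | mem w hw =>
        obtain ⟨i, rfl⟩ := hw
        exact h x hx i
      | zero => simp
      | add w w' _ _ hw hw' =>
        rw [mul_add]
        exact add_mem hw hw'
      | smul c w _ hw =>
        rw [mul_smul_comm]
        exact Submodule.smul_mem _ c hw
    | algebraMap c =>
      intro w hw
      rw [← Algebra.smul_def]
      exact Submodule.smul_mem _ c hw
    | add a b _ _ ha hb =>
      intro w hw
      rw [add_mul]
      exact add_mem (ha w hw) (hb w hw)
    | mul a b _ _ ha hb =>
      intro w hw
      rw [mul_assoc]
      exact ha _ (hb w hw)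
  intro a ha
  simpa using key a ha 1 h1

lemma aeval_mem_subalgebra {A : Subalgebra k L} {T : L} (hT : T ∈ A) (p : k[X]) :
    aeval T p ∈ A := by
  rw [aeval_eq_sum_range]
  exact A.sum_mem fun i _ => A.smul_mem (A.pow_mem hT i) _

/-- If a span contains a subalgebra whose closure contains all quotients of polynomials in `T`,
then its closure does so. -/
lemma aeval_div_mem_closure_span {ι : Type*} {v : ι → L} {A : Subalgebra k L} {T : L}
    (hA : (A : Set L) ⊆ Submodule.span k (Set.range v)) (hT : T ∈ A)
    (hinv : ∀ p : k[X], p ≠ 0 → (aeval T p)⁻¹ ∈ A.topologicalClosure) (p q : k[X]) :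
    aeval T p / aeval T q ∈ closure (Submodule.span k (Set.range v) : Set L) := by
  refine closure_mono hA ?_
  change _ ∈ A.topologicalClosure
  by_cases hq : q = 0
  · simp [hq]
  rw [div_eq_mul_inv]
  exact A.topologicalClosure.mul_mem (A.le_topologicalClosure (aeval_mem_subalgebra hT p))
    (hinv q hq)

/-- The monomials are orthogonal and total if no positive power of `‖T‖` is a value of `k`. -/
theorem isOrthogonalTotal_zpow [IsUltrametricDist L] {T : L} (hT : T ≠ 0)
    (h : ∀ m : ℕ, 0 < m → ∀ a : k, ‖a‖ ≠ ‖T‖ ^ m)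
    (hfrac : ∀ x : L, ∃ p q : k[X], x = aeval T p / aeval T q) :
    IsOrthogonalTotal k fun i : ℤ => T ^ i where
  ne_zero i := zpow_ne_zero i hT
  orthogonal := IsNormOrthogonal.of_norm_injective fun _ _ hij _ _ hab =>
    eq_zero_of_norm_mul_zpow_eq hT (h _ (Int.natAbs_pos.2 (sub_ne_zero.2 hij))) hab
  dense := by
    set A := Algebra.adjoin k {T, T⁻¹} with hAdef
    have hTA : T ∈ A := Algebra.subset_adjoin (by simp)
    have hTA' : T⁻¹ ∈ A := Algebra.subset_adjoin (by simp)
    have hA : (A : Set L) ⊆ Submodule.span k (Set.range fun i : ℤ => T ^ i) := by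
      refine adjoin_subset_span (Submodule.subset_span ⟨0, by simp⟩) ?_
      rintro x (rfl | rfl) i
      · exact Submodule.subset_span ⟨1 + i, by simp [zpow_add₀ hT]⟩
      · exact Submodule.subset_span ⟨-1 + i, by simp [zpow_add₀ hT]⟩
    intro x
    obtain ⟨p, q, rfl⟩ := hfrac x
    refine aeval_div_mem_closure_span hA hTA (fun p hp => ?_) p q
    -- The dominant monomial serves as the approximation of `p(T)`: its inverse is a Laurent
    -- monomial, and no other term can reach its norm.
    obtain ⟨m, hm, hmax⟩ := Finset.exists_max_image p.support (fun i => ‖p.coeff i • T ^ i‖)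
      (Polynomial.support_nonempty.2 hp)
    have hm0 : p.coeff m ≠ 0 := Polynomial.mem_support_iff.1 hm
    have hx0 : 0 < ‖p.coeff m • T ^ m‖ := norm_pos_iff.2 (smul_ne_zero hm0 (pow_ne_zero _ hT))
    refine inv_mem_topologicalClosure (x := p.coeff m • T ^ m) (aeval_mem_subalgebra hTA p) ?_ ?_
    · rw [Algebra.smul_def, mul_inv, ← map_inv₀, ← Algebra.smul_def, ← inv_pow]
      exact A.smul_mem (A.pow_mem hTA' m) _
    · rw [aeval_def, eval₂_eq_sum, Polynomial.sum, ← Finset.add_sum_erase _ _ hm,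
        ← Algebra.smul_def, add_sub_cancel_left]
      refine norm_sum_lt_of_forall_lt hx0 fun i hi => ?_
      rw [← Algebra.smul_def]
      have hi' := Finset.mem_erase.1 hi
      refine lt_of_le_of_ne (hmax i hi'.2) fun he => ?_
      rw [norm_smul, norm_smul, ← zpow_natCast, ← zpow_natCast] at he
      exact Polynomial.mem_support_iff.1 hi'.2
        (eq_zero_of_norm_mul_zpow_eq hT
          (h _ (Int.natAbs_pos.2 (sub_ne_zero.2 (by exact_mod_cast hi'.1)))) he)

end OneVariable

/-! ### Reduction modulo the maximal ideal. -/

section Reduction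

open Polynomial

lemma mem_integerRing_iff {k : Type*} [NormedField k] [IsUltrametricDist k] {x : k} :
    x ∈ integerRing k ↔ ‖x‖ ≤ 1 := by
  rw [Valuation.mem_valuationSubring_iff, NormedField.valuation_apply, ← NNReal.coe_le_coe]
  simp

lemma residue_eq_zero_iff_norm_lt_one {k : Type*} [NormedField k] [IsUltrametricDist k]
    (x : integerRing k) : IsLocalRing.residue (integerRing k) x = 0 ↔ ‖(x : k)‖ < 1 := by
  have hx : ‖(x : k)‖ ≤ 1 := mem_integerRing_iff.1 x.2
  rw [IsLocalRing.residue_eq_zero_iff, IsLocalRing.mem_maximalIdeal, mem_nonunits_iff]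
  constructor
  · intro h
    refine lt_of_le_of_ne hx fun h1 => h ?_
    have h0 : (x : k) ≠ 0 := norm_ne_zero_iff.1 (by rw [h1]; exact one_ne_zero)
    refine IsUnit.of_mul_eq_one ⟨(x : k)⁻¹, mem_integerRing_iff.2 (by rw [norm_inv, h1, inv_one])⟩
      (Subtype.ext (mul_inv_cancel₀ h0))
  · rintro h ⟨u, rfl⟩
    have h1 : ((u : integerRing k) : k) * ((u⁻¹ : (integerRing k)ˣ) : integerRing k) = 1 := by
      rw [← MulMemClass.coe_mul, Units.mul_inv, OneMemClass.coe_one]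
    have h2 : ‖(((u⁻¹ : (integerRing k)ˣ) : integerRing k) : k)‖ ≤ 1 :=
      mem_integerRing_iff.1 (Subtype.mem _)
    have h3 := congrArg norm h1
    rw [norm_mul, norm_one] at h3
    exact absurd h3 (mul_lt_one_of_nonneg_of_lt_one_left (norm_nonneg _) h h2).ne

lemma map_residue_eq_zero_iff {k : Type*} [NormedField k] [IsUltrametricDist k]
    (P : (integerRing k)[X]) : P.map (IsLocalRing.residue (integerRing k)) = 0 ↔
      ∀ i, ‖(P.coeff i : k)‖ < 1 := by
  simp only [Polynomial.ext_iff, coeff_map, coeff_zero, residue_eq_zero_iff_norm_lt_one]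

variable {k L : Type*} [NormedField k] [IsUltrametricDist k] [NormedField L] [NormedAlgebra k L]

/-- Evaluation at `S` of polynomials over the ring of integers. -/
def integralEval (k : Type*) [NormedField k] [IsUltrametricDist k] [NormedAlgebra k L] (S : L) :
    (integerRing k)[X] →+* L :=
  ((aeval S : k[X] →ₐ[k] L) : k[X] →+* L).comp (mapRingHom (algebraMap (integerRing k) k))

lemma integralEval_apply (S : L) (P : (integerRing k)[X]) :
    integralEval k S P = aeval S (P.map (algebraMap (integerRing k) k)) := rfl

@[simp] lemma integralEval_X (S : L) : integralEval k S X = S := by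
  simp [integralEval_apply]

@[simp] lemma integralEval_C (S : L) (c : integerRing k) :
    integralEval k S (C c) = algebraMap k L c := by
  simp [integralEval_apply]

/-- The powers of `S` are orthonormal over `k`. -/
def HasOrthonormalPowers (k : Type*) [NormedField k] [NormedAlgebra k L] (S : L) : Prop :=
  ‖S‖ = 1 ∧ IsNormOrthogonal k fun i : ℕ => S ^ i

namespace HasOrthonormalPowers

variable {S : L} (hS : HasOrthonormalPowers k S)
include hS

omit [IsUltrametricDist k] in
lemma norm_coeff_le (p : k[X]) (i : ℕ) : ‖p.coeff i‖ ≤ ‖aeval S p‖ := by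
  by_cases hi : i ∈ p.support
  · have := hS.2 p.support p.coeff i hi
    rw [aeval_def, eval₂_eq_sum, Polynomial.sum]
    simpa [hS.1, Algebra.smul_def] using this
  · rw [Polynomial.notMem_support_iff.1 hi, norm_zero]
    exact norm_nonneg _

variable [IsUltrametricDist L]

lemma norm_integralEval_le (P : (integerRing k)[X]) : ‖integralEval k S P‖ ≤ 1 := by
  rw [integralEval_apply, aeval_eq_sum_range]
  refine IsUltrametricDist.norm_sum_le_of_forall_le_of_nonneg zero_le_one fun i _ => ?_
  rw [norm_smul, norm_pow, hS.1, one_pow, mul_one, coeff_map]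
  exact mem_integerRing_iff.1 (P.coeff i).2

/-- Orthonormality of the powers of `S` bounds each coefficient by the norm of the value. This is
the bridge between norms in `L` and polynomials over the residue field. -/
lemma norm_integralEval_lt_one_iff (P : (integerRing k)[X]) :
    ‖integralEval k S P‖ < 1 ↔ P.map (IsLocalRing.residue (integerRing k)) = 0 := by
  rw [map_residue_eq_zero_iff]
  constructor
  · intro h i
    have := hS.norm_coeff_le (P.map (algebraMap (integerRing k) k)) i
    rw [coeff_map] at this
    exact this.trans_lt h
  · intro h
    rw [integralEval_apply, aeval_eq_sum_range]
    refine norm_sum_lt_of_forall_lt one_pos fun i _ => ?_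
    rw [norm_smul, norm_pow, hS.1, one_pow, mul_one, coeff_map]
    exact h i

lemma norm_integralEval_eq_one {P : (integerRing k)[X]}
    (h : P.map (IsLocalRing.residue (integerRing k)) ≠ 0) : ‖integralEval k S P‖ = 1 :=
  le_antisymm (hS.norm_integralEval_le P)
    (not_lt.1 fun hlt => h ((hS.norm_integralEval_lt_one_iff P).1 hlt))

lemma norm_integralEval_eq_one_of_monic {P : (integerRing k)[X]} (h : P.Monic) :
    ‖integralEval k S P‖ = 1 :=
  hS.norm_integralEval_eq_one (h.map _).ne_zero

lemma integralEval_ne_zero_of_monic {P : (integerRing k)[X]} (h : P.Monic) :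
    integralEval k S P ≠ 0 :=
  norm_ne_zero_iff.1 (by rw [hS.norm_integralEval_eq_one_of_monic h]; exact one_ne_zero)

end HasOrthonormalPowers

lemma partialFractionFamily_inl (Ps : Set (integerRing k)[X]) (S : L) (i : ℕ) :
    partialFractionFamily Ps S (.inl i) = S ^ i := rfl

lemma partialFractionFamily_inr (Ps : Set (integerRing k)[X]) (S : L) (P : Ps)
    (d : Fin P.1.natDegree) (m : ℕ) : partialFractionFamily Ps S (.inr ⟨P, d, m⟩) =
      S ^ (d : ℕ) / integralEval k S P.1 ^ (m + 1) := rfl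

lemma norm_partialFractionFamily [IsUltrametricDist L] {S : L} (hS : HasOrthonormalPowers k S)
    {Ps : Set (integerRing k)[X]} (hPs : IsIrreducibleLift Ps) (j) :
    ‖partialFractionFamily Ps S j‖ = 1 := by
  rcases j with i | ⟨P, d, m⟩
  · rw [partialFractionFamily_inl, norm_pow, hS.1, one_pow]
  · rw [partialFractionFamily_inr, norm_div, norm_pow, norm_pow, hS.1,
      hS.norm_integralEval_eq_one_of_monic (hPs.1 _ P.2)]
    simp

/-- Orthogonality can be tested on combinations with integral coefficients. -/
lemma IsNormOrthogonal.of_integral {J : Type*} {v : J → L} (hv : ∀ j, ‖v j‖ = 1)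
    (h : ∀ (s : Finset J) (c : J → integerRing k), ‖∑ j ∈ s, (c j : k) • v j‖ < 1 →
      ∀ j ∈ s, ‖(c j : k)‖ < 1) : IsNormOrthogonal k v := by
  intro s c j hj
  obtain ⟨m, hm, hmax⟩ := Finset.exists_max_image s (fun i => ‖c i‖) ⟨j, hj⟩
  rw [hv, mul_one]
  refine (hmax j hj).trans ?_
  -- Otherwise, dividing by the largest coefficient `c m` gives an integral combination of norm `<
  -- 1` whose coefficient at `m` is `1`.
  by_contra! hlt
  have hm0 : 0 < ‖c m‖ := (norm_nonneg _).trans_lt hlt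
  have hcm : c m ≠ 0 := norm_pos_iff.1 hm0
  classical
  let c' : J → integerRing k := fun i => if hi : i ∈ s then
    ⟨(c m)⁻¹ * c i, mem_integerRing_iff.2 (by
      rw [norm_mul, norm_inv, inv_mul_le_iff₀ hm0, mul_one]
      exact hmax i hi)⟩ else 0
  have hc' : ∀ i ∈ s, (c' i : k) = (c m)⁻¹ * c i := fun i hi => by simp [c', hi]
  have := h s c' (by
    rw [Finset.sum_congr rfl fun i hi => by rw [hc' i hi, mul_smul], ← Finset.smul_sum,
      norm_smul, norm_inv, inv_mul_lt_iff₀ hm0, mul_one]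
    exact hlt) m hm
  rw [hc' m hm, inv_mul_cancel₀ hcm, norm_one] at this
  exact lt_irrefl _ this

end Reduction

/-! ### Orthogonality of partial fractions. -/

section PartialFractions

open Polynomial

variable {k L : Type*} [NormedField k] [IsUltrametricDist k] [NormedField L] [NormedAlgebra k L]

/-- `P(S)` divides `z` up to an error of norm `< 1`, in the localization of `k°[S]` at the
polynomials whose reduction is prime to that of `P`. -/
def IsNearMultiple (S : L) (P : (integerRing k)[X]) (z : L) : Prop :=
  ∃ f g : (integerRing k)[X], ¬ P.map (IsLocalRing.residue (integerRing k)) ∣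
    g.map (IsLocalRing.residue (integerRing k)) ∧
    ‖z * integralEval k S g - integralEval k S P * integralEval k S f‖ < 1

variable [IsUltrametricDist L] {S : L} {P : (integerRing k)[X]}

omit [IsUltrametricDist L] in
lemma IsNearMultiple.of_norm_lt_one
    (hP : Irreducible (P.map (IsLocalRing.residue (integerRing k)))) {z : L} (hz : ‖z‖ < 1) :
    IsNearMultiple S P z :=
  ⟨0, 1, by simpa using fun h => hP.not_isUnit (isUnit_of_dvd_one h), by simpa using hz⟩

omit [IsUltrametricDist L] in
lemma IsNearMultiple.of_mul_eq {z : L} {f g : (integerRing k)[X]}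
    (hg : ¬ P.map (IsLocalRing.residue (integerRing k)) ∣
      g.map (IsLocalRing.residue (integerRing k)))
    (h : z * integralEval k S g = integralEval k S P * integralEval k S f) :
    IsNearMultiple S P z :=
  ⟨f, g, hg, by rw [h, sub_self, norm_zero]; exact one_pos⟩

/-- Take the product of the denominators; primality of the reduction of `P` keeps it prime to `P`.
-/
lemma IsNearMultiple.add (hS : HasOrthonormalPowers k S)
    (hP : Irreducible (P.map (IsLocalRing.residue (integerRing k)))) {z w : L}
    (hz : IsNearMultiple S P z) (hw : IsNearMultiple S P w) : IsNearMultiple S P (z + w) := by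
  obtain ⟨f, g, hg, h⟩ := hz
  obtain ⟨f', g', hg', h'⟩ := hw
  refine ⟨f * g' + f' * g, g * g', ?_, ?_⟩
  · rw [Polynomial.map_mul]
    exact fun hd => (hP.prime.dvd_or_dvd hd).elim hg hg'
  · have e : (z + w) * integralEval k S (g * g') -
        integralEval k S P * integralEval k S (f * g' + f' * g) =
        (z * integralEval k S g - integralEval k S P * integralEval k S f) *
          integralEval k S g' +
        (w * integralEval k S g' - integralEval k S P * integralEval k S f') *
          integralEval k S g := by
      simp only [map_mul, map_add]
      ring
    rw [e]
    refine (IsUltrametricDist.norm_add_le_max _ _).trans_lt (max_lt ?_ ?_) <;>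
    · rw [norm_mul]
      exact mul_lt_one_of_nonneg_of_lt_one_left (norm_nonneg _) (by assumption)
        (hS.norm_integralEval_le _)

/-- Clearing denominators shows that `a * g + P * f` has zero reduction. Hence the reduction of `P`
divides that of `a * g`, so that of `a`, whose degree is too small. -/
lemma IsNearMultiple.map_residue_eq_zero (hS : HasOrthonormalPowers k S) (hm : P.Monic)
    (hP : Irreducible (P.map (IsLocalRing.residue (integerRing k)))) {a : (integerRing k)[X]}
    {y : L} (hy : ‖y‖ < 1) (hdeg : a.degree < P.degree)
    (h : IsNearMultiple S P (y - integralEval k S a)) :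
    a.map (IsLocalRing.residue (integerRing k)) = 0 := by
  obtain ⟨f, g, hg, h⟩ := h
  have e : integralEval k S (a * g + P * f) = y * integralEval k S g -
      ((y - integralEval k S a) * integralEval k S g -
        integralEval k S P * integralEval k S f) := by
    simp only [map_mul, map_add]
    ring
  have hlt : ‖integralEval k S (a * g + P * f)‖ < 1 := by
    rw [e]
    refine (norm_sub_le_max_norm _ _).trans_lt (max_lt ?_ h)
    rw [norm_mul]
    exact mul_lt_one_of_nonneg_of_lt_one_left (norm_nonneg _) hy (hS.norm_integralEval_le _)
  rw [hS.norm_integralEval_lt_one_iff, Polynomial.map_add, Polynomial.map_mul,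
    Polynomial.map_mul] at hlt
  have hd : P.map (IsLocalRing.residue (integerRing k)) ∣
      a.map (IsLocalRing.residue (integerRing k)) *
        g.map (IsLocalRing.residue (integerRing k)) :=
    ⟨-(f.map (IsLocalRing.residue (integerRing k))), by linear_combination hlt⟩
  refine eq_zero_of_dvd_of_degree_lt ((hP.prime.dvd_or_dvd hd).resolve_right hg) ?_
  rw [hm.degree_map]
  exact degree_map_le.trans_lt hdeg

variable {Ps : Set (integerRing k)[X]}

lemma IsIrreducibleLift.irreducible (hPs : IsIrreducibleLift Ps) (P : Ps) :
    Irreducible (P.1.map (IsLocalRing.residue (integerRing k))) := (hPs.2.mapsTo P.2).2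

lemma IsIrreducibleLift.not_dvd (hPs : IsIrreducibleLift Ps) {P Q : Ps} (h : Q ≠ P) :
    ¬ P.1.map (IsLocalRing.residue (integerRing k)) ∣
      Q.1.map (IsLocalRing.residue (integerRing k)) := fun hd =>
  h (Subtype.ext (hPs.2.injOn Q.2 P.2 (eq_of_monic_of_associated (hPs.1 _ Q.2 |>.map _)
    (hPs.1 _ P.2 |>.map _) ((hPs.irreducible P).associated_of_dvd (hPs.irreducible Q) hd).symm)))

open Classical in
/-- The part of `c • v_j`, for `j = (P, d, m)`, which is not divisible by `P` after multiplication
by `P ^ (m + 1)`. -/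
def leadingNumerator (P : Ps) (m : ℕ) (c : integerRing k) :
    ℕ ⊕ (Σ P : Ps, Fin P.1.natDegree × ℕ) → (integerRing k)[X]
  | .inl _ => 0
  | .inr ⟨Q, d, m'⟩ => if Q = P ∧ m' = m then C c * X ^ (d : ℕ) else 0

/-- Coefficient `d` of a sum of leading numerators thus isolates the scalar attached to the single
index `(P, d, m)`. -/
lemma eq_of_coeff_leadingNumerator_ne_zero (P : Ps) (m : ℕ) (d : Fin P.1.natDegree) (c : integerRing k) (j) :
    (leadingNumerator P m c j).coeff d ≠ 0 → j = .inr ⟨P, d, m⟩ := by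
  intro h
  rcases j with i | ⟨Q, e, m'⟩
  · simp [leadingNumerator] at h
  · rw [leadingNumerator] at h
    split_ifs at h with hc
    · obtain ⟨rfl, rfl⟩ := hc
      rw [coeff_C_mul, coeff_X_pow] at h
      by_cases hde : d = e
      · rw [hde]
      · rw [if_neg fun h' => hde (Fin.ext h')] at h
        simp at h
    · simp at h

lemma leadingNumerator_mem_degreeLT (P : Ps) (m : ℕ) (c : integerRing k) (j) :
    leadingNumerator P m c j ∈ degreeLT (integerRing k) P.1.natDegree := by
  rw [mem_degreeLT]
  rcases j with i | ⟨Q, e, m'⟩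
  · simp [leadingNumerator, bot_lt_iff_ne_bot]
  · rw [leadingNumerator]
    split_ifs with hc
    · obtain ⟨rfl, rfl⟩ := hc
      exact (degree_C_mul_X_pow_le _ _).trans_lt (by exact_mod_cast e.2)
    · simp [bot_lt_iff_ne_bot]

/-- After multiplication by `P(S) ^ (m + 1)`, powers of `S` and poles at `P` of lower order keep a
factor `P(S)`. Poles at `Q ≠ P` keep one too, with denominator prime to `P`. Poles of the same order
are cancelled by the leading numerator, and poles of higher order have small coefficients by `hj`.
-/
lemma isNearMultiple_sub_leadingNumerator (hS : HasOrthonormalPowers k S)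
    (hPs : IsIrreducibleLift Ps) (P : Ps) (m : ℕ) (c : integerRing k) (j)
    (hj : ∀ d m', m < m' → j = .inr ⟨P, d, m'⟩ → ‖(c : k)‖ < 1) :
    IsNearMultiple S P.1 ((c : k) • partialFractionFamily Ps S j *
      integralEval k S P.1 ^ (m + 1) - integralEval k S (leadingNumerator P m c j)) := by
  have hP0 := hS.integralEval_ne_zero_of_monic (hPs.1 _ P.2)
  have h1 : ¬ P.1.map (IsLocalRing.residue (integerRing k)) ∣
      (1 : (integerRing k)[X]).map (IsLocalRing.residue (integerRing k)) := by
    simpa using fun h => (hPs.irreducible P).not_isUnit (isUnit_of_dvd_one h)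
  rcases j with i | ⟨Q, d, m'⟩
  · refine .of_mul_eq (f := C c * X ^ i * P.1 ^ m) h1 ?_
    simp only [sub_zero, partialFractionFamily_inl, leadingNumerator, map_mul, map_pow, map_one,
      integralEval_X, integralEval_C, Algebra.smul_def, map_zero]
    ring
  · rw [leadingNumerator, partialFractionFamily_inr]
    by_cases hQ : Q = P
    · subst hQ
      rcases lt_trichotomy m m' with hlt | rfl | hlt
      · refine IsNearMultiple.of_norm_lt_one (hPs.irreducible Q) ?_
        rw [if_neg (by simp [hlt.ne']), map_zero, sub_zero, norm_mul, norm_smul, norm_div,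
          norm_pow, norm_pow, norm_pow, hS.1,
          hS.norm_integralEval_eq_one_of_monic (hPs.1 _ Q.2)]
        simpa using hj d m' hlt rfl
      · refine IsNearMultiple.of_norm_lt_one (hPs.irreducible Q) ?_
        rw [if_pos ⟨rfl, rfl⟩, smul_mul_assoc, div_mul_cancel₀ _ (pow_ne_zero _ hP0)]
        simp [Algebra.smul_def]
      · obtain ⟨e, rfl⟩ := Nat.exists_eq_add_of_lt hlt
        refine .of_mul_eq (f := C c * X ^ (d : ℕ) * Q.1 ^ e) h1 ?_
        rw [if_neg (by simp [hlt.ne])]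
        simp only [map_mul, map_pow, map_one, integralEval_X, integralEval_C, Algebra.smul_def,
          map_zero, sub_zero, mul_one]
        field_simp
        ring
    · refine .of_mul_eq (f := C c * X ^ (d : ℕ) * P.1 ^ m) (g := Q.1 ^ (m' + 1)) ?_ ?_
      · rw [Polynomial.map_pow]
        exact fun h => hPs.not_dvd hQ ((hPs.irreducible P).prime.dvd_of_dvd_pow h)
      · have hQ0 := hS.integralEval_ne_zero_of_monic (hPs.1 _ Q.2)
        rw [if_neg (by simp [hQ])]
        simp only [map_mul, map_pow, integralEval_X, integralEval_C, Algebra.smul_def,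
          map_zero, sub_zero]
        field_simp
        ring

/-- Partial fractions are orthogonal. -/
theorem isNormOrthogonal_partialFractionFamily (hS : HasOrthonormalPowers k S)
    (hPs : IsIrreducibleLift Ps) : IsNormOrthogonal k (partialFractionFamily Ps S) := by
  classical
  refine IsNormOrthogonal.of_integral (norm_partialFractionFamily hS hPs) fun s c hc => ?_
  have hinr : ∀ P d m, .inr ⟨P, d, m⟩ ∈ s → ‖(c (.inr ⟨P, d, m⟩) : k)‖ < 1 := by
    by_contra! hbad
    obtain ⟨P, d, m, hjs, hj⟩ := hbad
    -- Among all polar terms with a coefficient of norm `≥ 1`, one of maximal pole order is chosen,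
    -- over all `P` at once. The value `0` of `idx` on powers of `S` is irrelevant, as `B` contains
    -- none.
    let B := s.filter fun j => ∃ x, j = .inr x ∧ 1 ≤ ‖(c j : k)‖
    let idx : ℕ ⊕ (Σ P : Ps, Fin P.1.natDegree × ℕ) → ℕ := Sum.elim (fun _ => 0) fun x => x.2.2
    obtain ⟨j, hjB, hmax⟩ := Finset.exists_max_image B idx
      ⟨_, Finset.mem_filter.2 ⟨hjs, _, rfl, hj⟩⟩
    obtain ⟨hjs, ⟨P, d, m⟩, rfl, hj⟩ := Finset.mem_filter.1 hjB
    set y := ∑ j ∈ s, (c j : k) • partialFractionFamily Ps S j with hy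
    set a := ∑ j ∈ s, leadingNumerator P m (c j) j with ha
    have hdeg : a.degree < P.1.degree := by
      rw [degree_eq_natDegree (hPs.1 _ P.2).ne_zero, ← mem_degreeLT]
      exact Submodule.sum_mem _ fun j _ => leadingNumerator_mem_degreeLT P m (c j) j
    have hnear : IsNearMultiple S P.1
        (y * integralEval k S P.1 ^ (m + 1) - integralEval k S a) := by
      rw [hy, ha, Finset.sum_mul, map_sum, ← Finset.sum_sub_distrib]
      refine Finset.sum_induction _ (IsNearMultiple S P.1)
        (fun _ _ => IsNearMultiple.add hS (hPs.irreducible P))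
        (IsNearMultiple.of_norm_lt_one (hPs.irreducible P) (by simp)) fun j hj => ?_
      refine isNearMultiple_sub_leadingNumerator hS hPs P m (c j) j ?_
      rintro d' m' hlt rfl
      by_contra! hge
      exact absurd (hmax _ (Finset.mem_filter.2 ⟨hj, _, rfl, hge⟩)) (not_le.2 hlt)
    have hzero := hnear.map_residue_eq_zero hS (hPs.1 _ P.2) (hPs.irreducible P) (by
      rwa [norm_mul, norm_pow, hS.norm_integralEval_eq_one_of_monic (hPs.1 _ P.2), one_pow,
        mul_one]) hdeg
    have hcoeff : a.coeff d = c (.inr ⟨P, d, m⟩) := by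
      rw [ha, finsetSum_coeff, Finset.sum_eq_single_of_mem _ hjs]
      · simp [leadingNumerator]
      · intro j _ hne
        by_contra h0
        exact hne (eq_of_coeff_leadingNumerator_ne_zero P m d (c j) j h0)
    have := (map_residue_eq_zero_iff _).1 hzero d
    rw [hcoeff] at this
    exact absurd this (not_lt.2 hj)
  -- All polar coefficients are now small, so removing the polar terms leaves a polynomial in `S` of
  -- norm `< 1`, whose reduction vanishes.
  let b : ℕ ⊕ (Σ P : Ps, Fin P.1.natDegree × ℕ) → (integerRing k)[X] :=
    fun j => Sum.elim (fun i => C (c j) * X ^ i) (fun _ => 0) j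
  have hb : ‖integralEval k S (∑ j ∈ s, b j)‖ < 1 := by
    rw [← sub_sub_self (∑ j ∈ s, (c j : k) • partialFractionFamily Ps S j)
      (integralEval k S (∑ j ∈ s, b j))]
    refine (norm_sub_le_max_norm _ _).trans_lt (max_lt hc ?_)
    rw [map_sum, ← Finset.sum_sub_distrib]
    refine norm_sum_lt_of_forall_lt one_pos ?_
    rintro (i | ⟨P, d, m⟩) hj
    · simp [b, partialFractionFamily_inl, Algebra.smul_def]
    · simpa [b, norm_smul, norm_partialFractionFamily hS hPs] using hinr P d m hj
  rintro (i | ⟨P, d, m⟩) hj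
  · have := (map_residue_eq_zero_iff _).1 ((hS.norm_integralEval_lt_one_iff _).1 hb) i
    rw [finsetSum_coeff, Finset.sum_eq_single_of_mem _ hj] at this
    · simpa [b] using this
    · rintro (i' | x) _ hne
      · have : i ≠ i' := fun h => hne (by rw [h])
        simp [b, coeff_X_pow, this]
      · simp [b]
  · exact hinr P d m hj

end PartialFractions

/-! ### Density of partial fractions. -/

section PartialFractionDensity

open Polynomial

variable {k L : Type*} [NormedField k] [IsUltrametricDist k] [NormedField L] [NormedAlgebra k L]
  {S : L} {Ps : Set (integerRing k)[X]}

/-- A monic polynomial with irreducible reduction is irreducible over `k°`, hence over `k` by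
Gauss's lemma; distinct monic irreducibles are coprime. -/
lemma IsIrreducibleLift.isCoprime (hPs : IsIrreducibleLift Ps) {P Q : Ps} (h : Q ≠ P) :
    IsCoprime (P.1.map (algebraMap (integerRing k) k))
      (Q.1.map (algebraMap (integerRing k) k)) := by
  have hirr : ∀ P : Ps, Irreducible (P.1.map (algebraMap (integerRing k) k)) := fun P =>
    (hPs.1 _ P.2).irreducible_iff_irreducible_map_fraction_map.1
      ((hPs.1 _ P.2).irreducible_of_irreducible_map _ _ (hPs.irreducible P))
  refine (hirr P).coprime_iff_not_dvd.2 fun hd => h (Subtype.ext ?_)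
  exact map_injective _ Subtype.val_injective
    (eq_of_monic_of_associated (hPs.1 _ Q.2 |>.map _) (hPs.1 _ P.2 |>.map _)
      ((hirr P).associated_of_dvd (hirr Q) hd).symm)

/-- The algebra generated by `S` and the inverses of the `P(S)`. -/
def partialFractionAlgebra (Ps : Set (integerRing k)[X]) (S : L) : Subalgebra k L :=
  Algebra.adjoin k (insert S (Set.range fun P : Ps => (integralEval k S P.1)⁻¹))

lemma mem_partialFractionAlgebra : S ∈ partialFractionAlgebra Ps S :=
  Algebra.subset_adjoin (Set.mem_insert _ _)

lemma inv_mem_partialFractionAlgebra (P : Ps) :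
    (integralEval k S P.1)⁻¹ ∈ partialFractionAlgebra Ps S :=
  Algebra.subset_adjoin (Set.mem_insert_of_mem _ ⟨P, rfl⟩)

/-- Every nonzero polynomial over the residue field lifts to a product of a unit and elements of
`Ps`. -/
lemma IsIrreducibleLift.exists_lift (hPs : IsIrreducibleLift Ps)
    (q : (IsLocalRing.ResidueField (integerRing k))[X]) (hq : q ≠ 0) :
    ∃ G : (integerRing k)[X], G.map (IsLocalRing.residue (integerRing k)) = q ∧
      (integralEval k S G)⁻¹ ∈ partialFractionAlgebra Ps S := by
  have hC : ∀ c : IsLocalRing.ResidueField (integerRing k), ∃ G : (integerRing k)[X],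
      G.map (IsLocalRing.residue (integerRing k)) = C c ∧
        (integralEval k S G)⁻¹ ∈ partialFractionAlgebra Ps S := by
    intro c
    obtain ⟨x, rfl⟩ := IsLocalRing.residue_surjective c
    refine ⟨C x, by simp, ?_⟩
    rw [integralEval_C, ← map_inv₀]
    exact Subalgebra.algebraMap_mem _ _
  have hmul : ∀ q₁ q₂ : (IsLocalRing.ResidueField (integerRing k))[X],
      (∃ G : (integerRing k)[X], G.map (IsLocalRing.residue (integerRing k)) = q₁ ∧
        (integralEval k S G)⁻¹ ∈ partialFractionAlgebra Ps S) →
      (∃ G : (integerRing k)[X], G.map (IsLocalRing.residue (integerRing k)) = q₂ ∧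
        (integralEval k S G)⁻¹ ∈ partialFractionAlgebra Ps S) →
      ∃ G : (integerRing k)[X], G.map (IsLocalRing.residue (integerRing k)) = q₁ * q₂ ∧
        (integralEval k S G)⁻¹ ∈ partialFractionAlgebra Ps S := by
    rintro _ _ ⟨G, rfl, hG⟩ ⟨G', rfl, hG'⟩
    refine ⟨G * G', by rw [Polynomial.map_mul], ?_⟩
    rw [map_mul, mul_inv]
    exact Subalgebra.mul_mem _ hG hG'
  induction q using UniqueFactorizationMonoid.induction_on_prime with
  | h₁ => exact absurd rfl hq
  | h₂ q hu =>
    obtain ⟨c, _, rfl⟩ := Polynomial.isUnit_iff.1 hu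
    exact hC c
  | h₃ a p ha hp ih =>
    refine hmul _ _ ?_ (ih ha)
    -- A prime factor is made monic so that it lifts to `Ps`; its leading coefficient is lifted
    -- separately as a scalar.
    have hlc : p.leadingCoeff ≠ 0 := leadingCoeff_ne_zero.2 hp.ne_zero
    have hu : IsUnit (C p.leadingCoeff⁻¹) := isUnit_C.2 (inv_ne_zero hlc).isUnit
    obtain ⟨P, hP, hPp⟩ := hPs.2.surjOn
      (show p * C p.leadingCoeff⁻¹ ∈ {Q | Q.Monic ∧ Irreducible Q} from
        ⟨monic_mul_leadingCoeff_inv hp.ne_zero,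
          (irreducible_mul_isUnit hu).2 hp.irreducible⟩)
    have := hmul _ _ ⟨P, hPp, inv_mem_partialFractionAlgebra ⟨P, hP⟩⟩ (hC p.leadingCoeff)
    rwa [mul_assoc, ← C_mul, inv_mul_cancel₀ hlc, C_1, mul_one] at this

/-- A nonzero polynomial is a scalar multiple of an integral one with nonzero reduction. -/
lemma exists_integral_multiple {p : k[X]} (hp : p ≠ 0) :
    ∃ (c : k) (P : (integerRing k)[X]), c ≠ 0 ∧
      P.map (IsLocalRing.residue (integerRing k)) ≠ 0 ∧
      p = C c * P.map (algebraMap (integerRing k) k) := by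
  obtain ⟨m, hm, hmax⟩ := Finset.exists_max_image p.support (fun i => ‖p.coeff i‖)
    (Polynomial.support_nonempty.2 hp)
  have hm0 : p.coeff m ≠ 0 := Polynomial.mem_support_iff.1 hm
  have hlift : C (p.coeff m)⁻¹ * p ∈ lifts (algebraMap (integerRing k) k) := by
    rw [lifts_iff_coeff_lifts]
    intro i
    suffices h : ‖(C (p.coeff m)⁻¹ * p).coeff i‖ ≤ 1 from ⟨⟨_, mem_integerRing_iff.2 h⟩, rfl⟩
    rw [coeff_C_mul, norm_mul, norm_inv, inv_mul_le_iff₀ (norm_pos_iff.2 hm0), mul_one]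
    by_cases hi : i ∈ p.support
    · exact hmax i hi
    · rw [Polynomial.notMem_support_iff.1 hi, norm_zero]
      exact norm_nonneg _
  obtain ⟨P, hP⟩ := (mem_lifts _).1 hlift
  refine ⟨p.coeff m, P, hm0, fun h0 => ?_, ?_⟩
  · have h1 := (map_residue_eq_zero_iff _).1 h0 m
    have h2 := congrArg (fun q : k[X] => q.coeff m) hP
    simp only [coeff_map, coeff_C_mul, inv_mul_cancel₀ hm0] at h2
    change ((P.coeff m : integerRing k) : k) = 1 at h2
    rw [h2, norm_one] at h1
    exact lt_irrefl _ h1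
  · rw [hP, ← mul_assoc, ← C_mul, mul_inv_cancel₀ hm0, C_1, one_mul]

lemma inv_pow_mem_span_partialFractionFamily (hPs : IsIrreducibleLift Ps) (P : Ps) (m : ℕ) :
    (integralEval k S P.1 ^ m)⁻¹ ∈
      Submodule.span k (Set.range (partialFractionFamily Ps S)) := by
  rcases m with _ | m
  · exact Submodule.subset_span ⟨.inl 0, by simp [partialFractionFamily_inl]⟩
  · have hd : 0 < P.1.natDegree := by
      have h := (hPs.irreducible P).natDegree_pos
      rwa [(hPs.1 _ P.2).natDegree_map] at h
    exact Submodule.subset_span ⟨.inr ⟨P, ⟨0, hd⟩, m⟩, by simp [partialFractionFamily_inr]⟩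

variable [IsUltrametricDist L]

lemma mul_mem_span_partialFractionFamily (hS : HasOrthonormalPowers k S)
    (hPs : IsIrreducibleLift Ps) (j) : S * partialFractionFamily Ps S j ∈
      Submodule.span k (Set.range (partialFractionFamily Ps S)) := by
  rcases j with i | ⟨P, d, m⟩
  · exact Submodule.subset_span ⟨.inl (i + 1), by simp [partialFractionFamily_inl, pow_succ']⟩
  by_cases hd : (d : ℕ) + 1 < P.1.natDegree
  · exact Submodule.subset_span ⟨.inr ⟨P, ⟨d + 1, hd⟩, m⟩, by
      rw [partialFractionFamily_inr, partialFractionFamily_inr, pow_succ' S, mul_div_assoc]⟩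
  have hd' : (d : ℕ) + 1 = P.1.natDegree := le_antisymm d.2 (not_lt.1 hd)
  have hP0 := hS.integralEval_ne_zero_of_monic (hPs.1 _ P.2)
  have hsum := congrArg (integralEval k S) (hPs.1 _ P.2).as_sum
  simp only [map_add, map_sum, map_mul, map_pow, integralEval_X, integralEval_C] at hsum
  -- At the last index `d = deg P - 1`, monicity rewrites `S ^ deg P` as `P(S)` minus lower terms;
  -- the term `P(S)` lowers the pole order by one.
  have e : S * partialFractionFamily Ps S (.inr ⟨P, d, m⟩) =
      (integralEval k S P.1 ^ m)⁻¹ - ∑ i : Fin P.1.natDegree,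
        ((P.1.coeff i : integerRing k) : k) •
          partialFractionFamily Ps S (.inr ⟨P, i, m⟩) := by
    simp only [partialFractionFamily_inr, Algebra.smul_def, ← mul_div_assoc]
    rw [← Finset.sum_div, Fin.sum_univ_eq_sum_range
      (fun i => algebraMap k L ((P.1.coeff i : integerRing k) : k) * S ^ i), ← pow_succ', hd',
      ← sub_eq_of_eq_add hsum]
    field_simp
    ring
  rw [e]
  exact sub_mem (inv_pow_mem_span_partialFractionFamily hPs P m)
    (sum_mem fun i _ => Submodule.smul_mem _ _ (Submodule.subset_span ⟨_, rfl⟩))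

lemma aeval_mul_mem_span_partialFractionFamily (hS : HasOrthonormalPowers k S)
    (hPs : IsIrreducibleLift Ps) (p : k[X]) {w : L}
    (hw : w ∈ Submodule.span k (Set.range (partialFractionFamily Ps S))) :
    aeval S p * w ∈ Submodule.span k (Set.range (partialFractionFamily Ps S)) := by
  have hX : ∀ w ∈ Submodule.span k (Set.range (partialFractionFamily Ps S)),
      S * w ∈ Submodule.span k (Set.range (partialFractionFamily Ps S)) := by
    intro w hw
    induction hw using Submodule.span_induction with
    | mem w hw =>
      obtain ⟨j, rfl⟩ := hw
      exact mul_mem_span_partialFractionFamily hS hPs j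
    | zero => simp
    | add w w' _ _ hw hw' =>
      rw [mul_add]
      exact add_mem hw hw'
    | smul c w _ hw =>
      rw [mul_smul_comm]
      exact Submodule.smul_mem _ c hw
  have hpow : ∀ n : ℕ, S ^ n * w ∈ Submodule.span k (Set.range (partialFractionFamily Ps S)) := by
    intro n
    induction n with
    | zero => simpa using hw
    | succ n ih =>
      rw [pow_succ', mul_assoc]
      exact hX _ ih
  rw [aeval_eq_sum_range, Finset.sum_mul]
  exact sum_mem fun i _ => by
    rw [smul_mul_assoc]
    exact Submodule.smul_mem _ _ (hpow i)

lemma inv_mul_mem_span_partialFractionFamily (hS : HasOrthonormalPowers k S)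
    (hPs : IsIrreducibleLift Ps) (P : Ps) (j) :
    (integralEval k S P.1)⁻¹ * partialFractionFamily Ps S j ∈
      Submodule.span k (Set.range (partialFractionFamily Ps S)) := by
  have hP0 := hS.integralEval_ne_zero_of_monic (hPs.1 _ P.2)
  have hinv : ∀ (Q : Ps) (m : ℕ) (p : k[X]), aeval S p * (integralEval k S Q.1 ^ m)⁻¹ ∈
      Submodule.span k (Set.range (partialFractionFamily Ps S)) := fun Q m p =>
    aeval_mul_mem_span_partialFractionFamily hS hPs p
      (inv_pow_mem_span_partialFractionFamily hPs Q m)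
  rcases j with i | ⟨Q, d, m⟩
  · simpa [partialFractionFamily_inl, mul_comm] using hinv P 1 (X ^ i)
  by_cases hQ : Q = P
  · subst hQ
    refine Submodule.subset_span ⟨.inr ⟨Q, d, m + 1⟩, ?_⟩
    rw [partialFractionFamily_inr, partialFractionFamily_inr]
    field_simp
    ring
  · have hQ0 := hS.integralEval_ne_zero_of_monic (hPs.1 _ Q.2)
    -- From `u P + v Q ^ (m + 1) = 1` comes the splitting `1 / (P Q ^ (m + 1)) = u / Q ^ (m + 1) + v
    -- / P`.
    obtain ⟨u, v, huv⟩ := (hPs.isCoprime hQ).pow_right (n := m + 1)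
    have huv' := congrArg (aeval S) huv
    simp only [map_add, map_mul, map_pow, map_one, ← integralEval_apply] at huv'
    have e : (integralEval k S P.1)⁻¹ * partialFractionFamily Ps S (.inr ⟨Q, d, m⟩) =
        aeval S (X ^ (d : ℕ) * u) * (integralEval k S Q.1 ^ (m + 1))⁻¹ +
          aeval S (X ^ (d : ℕ) * v) * (integralEval k S P.1 ^ 1)⁻¹ := by
      rw [partialFractionFamily_inr]
      simp only [map_mul, map_pow, aeval_X]
      field_simp
      linear_combination -S ^ (d : ℕ) * huv'
    rw [e]
    exact add_mem (hinv _ _ _) (hinv _ _ _)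

lemma partialFractionAlgebra_subset_span (hS : HasOrthonormalPowers k S)
    (hPs : IsIrreducibleLift Ps) : (partialFractionAlgebra Ps S : Set L) ⊆
      Submodule.span k (Set.range (partialFractionFamily Ps S)) := by
  refine adjoin_subset_span (Submodule.subset_span ⟨.inl 0, by
    simp [partialFractionFamily_inl]⟩) ?_
  rintro x (rfl | ⟨P, rfl⟩) j
  · exact mul_mem_span_partialFractionFamily hS hPs j
  · exact inv_mul_mem_span_partialFractionFamily hS hPs P j

/-- Rational functions in `S` are limits of combinations of partial fractions. -/
theorem aeval_div_mem_closure_span_partialFractionFamily (hS : HasOrthonormalPowers k S)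
    (hPs : IsIrreducibleLift Ps) (p q : k[X]) : aeval S p / aeval S q ∈
      closure (Submodule.span k (Set.range (partialFractionFamily Ps S)) : Set L) := by
  refine aeval_div_mem_closure_span (partialFractionAlgebra_subset_span hS hPs)
    mem_partialFractionAlgebra (fun p hp => ?_) p q
  obtain ⟨c, P, hc, hP, rfl⟩ := exists_integral_multiple hp
  -- `P` and `G` have the same nonzero reduction, so `‖P(S) - G(S)‖ < 1 = ‖G(S)‖` and the inverse of
  -- `P(S)` can be approximated.
  obtain ⟨G, hG, hGinv⟩ := hPs.exists_lift (S := S) _ hP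
  rw [map_mul, aeval_C, mul_inv, ← map_inv₀]
  refine Subalgebra.mul_mem _ (Subalgebra.algebraMap_mem _ _) ?_
  rw [← integralEval_apply]
  refine inv_mem_topologicalClosure (aeval_mem_subalgebra mem_partialFractionAlgebra _) hGinv ?_
  rw [hS.norm_integralEval_eq_one (P := G) (by rwa [hG]), ← map_sub,
    hS.norm_integralEval_lt_one_iff, Polynomial.map_sub, hG, sub_self]

end PartialFractionDensity

/-! ### Adjoining the powers of `T` below `N`. -/

section ProductFamily

open Polynomial

variable {k L : Type*} [NormedField k] [NormedField L] [NormedAlgebra k L]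

/-- If `T ^ N ∈ k(S)`, every quotient of polynomials in `T` is a combination of
`1, T, …, T ^ (N - 1)` over `k(S)`. -/
lemma exists_eq_sum_pow_mul {S T : L} {N : ℕ} (hN : 0 < N)
    (hT : T ^ N ∈ IntermediateField.adjoin k {S}) (p q : k[X]) :
    ∃ f : Fin N → IntermediateField.adjoin k {S},
      aeval T p / aeval T q = ∑ a : Fin N, T ^ (a : ℕ) * (f a : L) := by
  set F := IntermediateField.adjoin k {S}
  -- `T` is a root of this monic polynomial over `k(S)`, so `F(T) = F[T]`, and remainders modulo `R`
  -- have degree `< N`.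
  let R : F[X] := X ^ N - C ⟨T ^ N, hT⟩
  have hR : R.Monic := monic_X_pow_sub_C _ hN.ne'
  have hRT : aeval T R = 0 := by
    simp only [R, map_sub, map_pow, aeval_X, aeval_C]
    exact sub_self _
  have hint : IsIntegral F T := ⟨R, hR, hRT⟩
  have hmem : ∀ p : k[X], aeval T p ∈ IntermediateField.adjoin F {T} := fun p => by
    rw [aeval_eq_sum_range]
    refine sum_mem fun i _ => ?_
    rw [Algebra.smul_def, IsScalarTower.algebraMap_apply k F L]
    exact mul_mem (IntermediateField.algebraMap_mem _ _)
      (pow_mem (IntermediateField.mem_adjoin_simple_self F T) i)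
  have hx : aeval T p / aeval T q ∈ (IntermediateField.adjoin F {T}).toSubalgebra :=
    div_mem (S := IntermediateField F L) (hmem p) (hmem q)
  rw [IntermediateField.adjoin_simple_toSubalgebra_of_isAlgebraic hint.isAlgebraic,
    Algebra.adjoin_singleton_eq_range_aeval] at hx
  obtain ⟨g, hg⟩ := hx
  change aeval T g = _ at hg
  refine ⟨fun a => (g %ₘ R).coeff a, ?_⟩
  have hdeg : (g %ₘ R).natDegree < N := by
    have h1 : R.natDegree = N := natDegree_X_pow_sub_C
    rw [← h1]
    refine natDegree_modByMonic_lt g hR fun h => ?_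
    rw [h, natDegree_one] at h1
    exact hN.ne h1
  rw [← hg, ← aeval_modByMonic_eq_self_of_root hRT,
    aeval_eq_sum_range' hdeg, ← Fin.sum_univ_eq_sum_range
      (fun i => (g %ₘ R).coeff i • T ^ i)]
  refine Finset.sum_congr rfl fun a _ => ?_
  rw [Algebra.smul_def, mul_comm]
  rfl

variable [IsUltrametricDist L] {T : L}

/-- Products of an orthonormal family with powers of `T` of distinct norms modulo `k`. -/
lemma IsNormOrthogonal.pow_mul {N : ℕ} (hT : T ≠ 0)
    (h : ∀ m : ℕ, 0 < m → m < N → ∀ a : k, ‖a‖ ≠ ‖T‖ ^ m) {J : Type*} {v : J → L}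
    (hv : IsNormOrthogonal k v) (hv1 : ∀ j, ‖v j‖ = 1) :
    IsNormOrthogonal k fun p : Fin N × J => T ^ (p.1 : ℕ) * v p.2 := by
  refine IsNormOrthogonal.of_prod fun s t c a ha b hb => ?_
  -- Each inner sum has its norm in `|k|`. Multiplied by distinct powers `T ^ a` with `a < N`,
  -- nonzero inner sums therefore get distinct norms.
  have hx : ∀ a, ∃ b, ‖∑ b ∈ t, c (a, b) • v b‖ = ‖c (a, b)‖ := fun a => by
    obtain ⟨b, _, h⟩ := hv.exists_norm_sum_eq ⟨b, hb⟩ fun b => c (a, b)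
    exact ⟨b, by rw [h, hv1, mul_one]⟩
  simp only [← mul_smul_comm, ← Finset.mul_sum]
  calc ‖c (a, b)‖ * ‖T ^ (a : ℕ) * v b‖ = ‖T ^ (a : ℕ)‖ * (‖c (a, b)‖ * ‖v b‖) := by
        rw [norm_mul]
        ring
    _ ≤ ‖T ^ (a : ℕ) * ∑ b ∈ t, c (a, b) • v b‖ := by
        rw [norm_mul]
        gcongr
        exact hv t (fun b => c (a, b)) b hb
    _ ≤ _ := by
        refine norm_le_norm_sum_of_norm_injOn
          (x := fun a : Fin N => T ^ (a : ℕ) * ∑ b ∈ t, c (a, b) • v b) ?_ ha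
        intro i _ j _ hij he
        obtain ⟨b, hb⟩ := hx i
        obtain ⟨b', hb'⟩ := hx j
        simp only [norm_mul, hb, hb'] at he
        rw [mul_comm, mul_comm _ ‖c (j, b')‖, ← zpow_natCast, ← zpow_natCast] at he
        have hne : (i : ℕ) ≠ j := fun h => hij (Fin.ext h)
        have h0 := eq_zero_of_norm_mul_zpow_eq hT (h _ (by omega) (by omega)) he
        rw [h0, norm_zero, norm_eq_zero] at hb
        simp only [hb, mul_zero]

omit [IsUltrametricDist L] in
/-- Powers of `c⁻¹ T ^ N` are orthonormal if those of `T` are orthogonal and `|c| = |T| ^ N`. -/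
lemma HasOrthonormalPowers.of_pow (hT : T ≠ 0) (hpow : IsNormOrthogonal k fun i : ℕ => T ^ i)
    {N : ℕ} (hN : 0 < N) {c : k} (hc : ‖c‖ = ‖T‖ ^ N) :
    HasOrthonormalPowers k (c⁻¹ • T ^ N) := by
  refine ⟨?_, ?_⟩
  · rw [norm_smul, norm_inv, norm_pow, hc,
      inv_mul_cancel₀ (pow_ne_zero _ (norm_ne_zero_iff.2 hT))]
  · have := (hpow.comp_injective (f := fun i => N * i)
      (fun i j h => Nat.eq_of_mul_eq_mul_left hN h)).smul fun i => c⁻¹ ^ i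
    simpa only [_root_.smul_pow, ← pow_mul] using this

/-- The explicit basis in one variable when `|T| ^ N` is a value of `k`, with `N` minimal. -/
theorem isOrthogonalTotal_pow_mul_partialFractionFamily [IsUltrametricDist k] (hT : T ≠ 0)
    (hpow : IsNormOrthogonal k fun i : ℕ => T ^ i)
    (hfrac : ∀ x : L, ∃ p q : k[X], x = aeval T p / aeval T q) {N : ℕ} (hN : 0 < N) {c : k}
    (hc : ‖c‖ = ‖T‖ ^ N) (h : ∀ m : ℕ, 0 < m → m < N → ∀ a : k, ‖a‖ ≠ ‖T‖ ^ m)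
    {Ps : Set (integerRing k)[X]} (hPs : IsIrreducibleLift Ps) :
    IsOrthogonalTotal k fun j : Fin N × (ℕ ⊕ (Σ P : Ps, Fin P.1.natDegree × ℕ)) =>
      T ^ (j.1 : ℕ) * partialFractionFamily Ps (c⁻¹ • T ^ N) j.2 := by
  have hS := HasOrthonormalPowers.of_pow hT hpow hN hc
  have hv1 := norm_partialFractionFamily hS hPs
  have hcl := aeval_div_mem_closure_span_partialFractionFamily hS hPs
  have hv := isNormOrthogonal_partialFractionFamily hS hPs
  have hc0 : c ≠ 0 := norm_ne_zero_iff.1 (by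
    rw [hc]
    exact pow_ne_zero _ (norm_ne_zero_iff.2 hT))
  have hTN : T ^ N = c • (c⁻¹ • T ^ N) := (smul_inv_smul₀ hc0 _).symm
  generalize c⁻¹ • T ^ N = S at *
  refine ⟨fun j => mul_ne_zero (pow_ne_zero _ hT) (norm_ne_zero_iff.1 (by simp [hv1])),
    hv.pow_mul hT h hv1, fun x => ?_⟩
  set D := (Submodule.span k (Set.range fun j : Fin N × (ℕ ⊕ (Σ P : Ps, Fin P.1.natDegree × ℕ)) =>
      T ^ (j.1 : ℕ) * partialFractionFamily Ps S j.2)).topologicalClosure with hD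
  change x ∈ D
  obtain ⟨p, q, rfl⟩ := hfrac x
  obtain ⟨f, hf⟩ := exists_eq_sum_pow_mul (S := S) hN (by
    rw [hTN]
    exact IntermediateField.smul_mem _ (IntermediateField.mem_adjoin_simple_self k S)) p q
  rw [hf]
  refine D.sum_mem fun a _ => ?_
  -- Each coefficient is a rational function of `S`, hence a limit of partial fractions;
  -- multiplication by `T ^ a` is continuous.
  obtain ⟨p', q', hpq⟩ := (IntermediateField.mem_adjoin_simple_iff k _).1 (f a).2
  rw [hpq]
  have hclosed : IsClosed {y : L | T ^ (a : ℕ) * y ∈ D} :=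
    (Submodule.isClosed_topologicalClosure _).preimage (continuous_const.mul continuous_id)
  refine closure_minimal ?_ hclosed (hcl p' q')
  intro y hy
  induction hy using Submodule.span_induction with
  | mem y hy =>
    obtain ⟨j, rfl⟩ := hy
    exact Submodule.le_topologicalClosure _ (Submodule.subset_span ⟨(a, j), rfl⟩)
  | zero => simp
  | add y z _ _ hy hz =>
    simp only [Set.mem_ofPred_eq, mul_add] at *
    exact D.add_mem hy hz
  | smul b y _ hy =>
    simp only [Set.mem_ofPred_eq, mul_smul_comm] at *
    exact D.smul_mem b hy

lemma exists_isIrreducibleLift (k : Type*) [NormedField k] [IsUltrametricDist k] :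
    ∃ Ps : Set (integerRing k)[X], IsIrreducibleLift Ps := by
  have hlift : ∀ Q : {Q : (IsLocalRing.ResidueField (integerRing k))[X] // Q.Monic ∧
      Irreducible Q}, ∃ P : (integerRing k)[X],
      P.map (IsLocalRing.residue (integerRing k)) = Q.1 ∧ P.Monic := fun Q => by
    obtain ⟨P, hP, _, hm⟩ := lifts_and_natDegree_eq_and_monic
      ((mem_lifts _).2 (map_surjective _ IsLocalRing.residue_surjective Q.1)) Q.2.1
    exact ⟨P, hP, hm⟩
  choose P hP hm using hlift
  refine ⟨Set.range P, by rintro _ ⟨Q, rfl⟩; exact hm Q, ?_, ?_, ?_⟩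
  · rintro _ ⟨Q, rfl⟩
    rw [hP]
    exact Q.2
  · rintro _ ⟨Q, rfl⟩ _ ⟨Q', rfl⟩ h
    rw [hP, hP] at h
    rw [Subtype.ext h]
  · intro Q hQ
    exact ⟨P ⟨Q, hQ⟩, ⟨_, rfl⟩, hP _⟩

end ProductFamily

/-- A one-variable Gauss extension has an orthogonal total family. -/
theorem exists_isOrthogonalTotal_of_pow {k L : Type u} [NormedField k] [NormedField L]
    [NormedAlgebra k L] [IsUltrametricDist k] [IsUltrametricDist L] {T : L} (hT : T ≠ 0)
    (hpow : IsNormOrthogonal k fun i : ℕ => T ^ i)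
    (hfrac : ∀ x : L, ∃ p q : Polynomial k,
      x = Polynomial.aeval T p / Polynomial.aeval T q) :
    ∃ (J : Type u) (v : J → L), IsOrthogonalTotal k v := by
  classical
  by_cases h : ∃ m : ℕ, 0 < m ∧ ∃ a : k, ‖a‖ = ‖T‖ ^ m
  · obtain ⟨Ps, hPs⟩ := exists_isIrreducibleLift k
    obtain ⟨hN, c, hc⟩ := Nat.find_spec h
    exact ⟨_, _, isOrthogonalTotal_pow_mul_partialFractionFamily hT hpow hfrac hN hc
      (fun m hm hlt a ha => Nat.find_min h hlt ⟨hm, a, ha⟩) hPs⟩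
  · push Not at h
    -- `ULift` places the index set in the universe of `k`.
    exact ⟨ULift ℤ, _, (isOrthogonalTotal_zpow hT h hfrac).comp_equiv Equiv.ulift⟩

/-! ### The Gauss field as a one-variable extension; induction on the variables. -/

section GaussFieldOneVariable

open MvPolynomial

variable {k : Type*} [NormedField k] {n : ℕ}

/-- The polyradius with its first entry removed. -/
def Polyradius.tail (r : Polyradius (n + 1)) : Polyradius n := fun i => r i.succ

lemma Polyradius.monom_cons (r : Polyradius (n + 1)) (i : ℕ) (t : Fin n →₀ ℕ) :
    r.monom (t.cons i) = (r 0 : ℝ≥0) ^ i * r.tail.monom t := by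
  simp [Polyradius.monom, Polyradius.tail, Fin.prod_univ_succ]

/-- The coefficients of the `i`-th coefficient in `T₀` are coefficients of `p`. This is the source
of the orthogonality of the powers of `T₀`. -/
lemma gaussNNNorm_coeff_mul_le (r : Polyradius (n + 1)) (p : MvPolynomial (Fin (n + 1)) k)
    (i : ℕ) : gaussNNNorm r.tail ((finSuccEquiv k n p).coeff i) * (r 0 : ℝ≥0) ^ i ≤
      gaussNNNorm r p := by
  rw [← le_div_iff₀ (pow_pos (r 0).2 i)]
  refine gaussNNNorm_le _ fun t => ?_
  rw [le_div_iff₀ (pow_pos (r 0).2 i), finSuccEquiv_coeff_coeff, mul_assoc,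
    mul_comm (r.tail.monom t), ← r.monom_cons]
  exact le_gaussNNNorm r p _

lemma finSuccEquiv_rename_succ {k : Type*} [CommRing k] {n : ℕ} (q : MvPolynomial (Fin n) k) :
    finSuccEquiv k n (rename Fin.succ q) = Polynomial.C q := by
  induction q using MvPolynomial.induction_on with
  | C a => simp [finSuccEquiv_apply]
  | add p q hp hq => rw [map_add, map_add, hp, hq, Polynomial.C_add]
  | mul_X p i hp => rw [map_mul, map_mul, hp, rename_X, finSuccEquiv_X_succ, Polynomial.C_mul]

lemma gaussNNNorm_rename_succ (r : Polyradius (n + 1)) (q : MvPolynomial (Fin n) k) :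
    gaussNNNorm r (rename Fin.succ q) = gaussNNNorm r.tail q := by
  apply le_antisymm
  · refine gaussNNNorm_le _ fun t => ?_
    rw [← t.cons_tail, r.monom_cons, ← finSuccEquiv_coeff_coeff, finSuccEquiv_rename_succ,
      Polynomial.coeff_C]
    split_ifs with h
    · rw [h, pow_zero, one_mul]
      exact le_gaussNNNorm r.tail q _
    · simp
  · simpa [finSuccEquiv_rename_succ] using gaussNNNorm_coeff_mul_le r (rename Fin.succ q) 0

lemma gaussNNNorm_X (r : Polyradius n) (i : Fin n) :
    gaussNNNorm r (X i : MvPolynomial (Fin n) k) = r i := by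
  classical
  have hm : r.monom (Finsupp.single i 1) = r i := by
    rw [Polyradius.monom, Finset.prod_eq_single_of_mem i (Finset.mem_univ i)]
    · simp
    · intro j _ hj
      rw [Finsupp.single_eq_of_ne hj, pow_zero]
  apply le_antisymm
  · refine gaussNNNorm_le r fun t => ?_
    rw [coeff_X]
    split_ifs with h
    · rw [← h, hm, nnnorm_one, one_mul]
    · simp
  · simpa [hm] using le_gaussNNNorm r (X i : MvPolynomial (Fin n) k) (Finsupp.single i 1)

namespace GaussField

variable [IsUltrametricDist k]

lemma norm_T (r : Polyradius n) (i : Fin n) : ‖(T r i : GaussField k r)‖ = (r i : ℝ≥0) := by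
  rw [T, norm_algebraMap_polynomial, gaussNNNorm_X]

lemma T_ne_zero (r : Polyradius n) (i : Fin n) : (T r i : GaussField k r) ≠ 0 :=
  norm_ne_zero_iff.1 (by
    rw [norm_T]
    exact_mod_cast (r i).2.ne')

lemma gaussNNNorm_mul_le_norm_sum (r : Polyradius (n + 1)) (s : Finset ℕ)
    (P : ℕ → MvPolynomial (Fin n) k) {j : ℕ} (hj : j ∈ s) :
    gaussNNNorm r.tail (P j) * ‖(T r 0 ^ j : GaussField k r)‖ ≤
      ‖∑ i ∈ s, algebraMap (MvPolynomial (Fin (n + 1)) k) (GaussField k r)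
        (rename Fin.succ (P i)) * T r 0 ^ i‖ := by
  classical
  have e : ∑ i ∈ s, algebraMap (MvPolynomial (Fin (n + 1)) k) (GaussField k r)
      (rename Fin.succ (P i)) * T r 0 ^ i =
      algebraMap _ _ (∑ i ∈ s, rename Fin.succ (P i) * X 0 ^ i) := by
    simp [T]
  have h := gaussNNNorm_coeff_mul_le r (∑ i ∈ s, rename Fin.succ (P i) * X 0 ^ i) j
  have hc : (finSuccEquiv k n (∑ i ∈ s, rename Fin.succ (P i) * X 0 ^ i)).coeff j = P j := by
    simp [finSuccEquiv_rename_succ, finSuccEquiv_X_zero, Polynomial.coeff_X_pow, hj]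
  rw [hc] at h
  rw [e, norm_algebraMap_polynomial, norm_pow, norm_T]
  exact_mod_cast h

omit [IsUltrametricDist k] in
/-- If the variables other than the first come from `F`, the elements of `k(T / r)` are quotients
of polynomials in `T₀` over `F`. -/
lemma exists_eq_aeval_div {F : Type*} [Field F] (r : Polyradius (n + 1)) [Algebra k F]
    [Algebra F (GaussField k r)] [IsScalarTower k F (GaussField k r)]
    (hF : ∀ i : Fin n, ∃ y : F, algebraMap F (GaussField k r) y = T r i.succ)
    (x : GaussField k r) : ∃ p q : Polynomial F,
      x = Polynomial.aeval (T r 0) p / Polynomial.aeval (T r 0) q := by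
  have hpoly : ∀ a : MvPolynomial (Fin (n + 1)) k, ∃ f : Polynomial F,
      algebraMap _ (GaussField k r) a = Polynomial.aeval (T r 0) f := by
    intro a
    induction a using MvPolynomial.induction_on with
    | C a =>
      refine ⟨Polynomial.C (algebraMap k F a), ?_⟩
      rw [Polynomial.aeval_C, ← IsScalarTower.algebraMap_apply, ← MvPolynomial.algebraMap_eq,
        ← IsScalarTower.algebraMap_apply]
    | add a b ha hb =>
      obtain ⟨f, hf⟩ := ha
      obtain ⟨g, hg⟩ := hb
      exact ⟨f + g, by rw [map_add, hf, hg, map_add]⟩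
    | mul_X a i ha =>
      obtain ⟨f, hf⟩ := ha
      have hi : ∃ g : Polynomial F,
          (T r i : GaussField k r) = Polynomial.aeval (T r 0) g := by
        refine Fin.cases ⟨Polynomial.X, by simp⟩ (fun i => ?_) i
        obtain ⟨y, hy⟩ := hF i
        exact ⟨Polynomial.C y, by simp [hy]⟩
      obtain ⟨g, hg⟩ := hi
      exact ⟨f * g, by rw [map_mul, hf, map_mul, ← hg]; rfl⟩
  obtain ⟨a, b, _, rfl⟩ := IsFractionRing.div_surjective (A := MvPolynomial (Fin (n + 1)) k) x
  obtain ⟨f, hf⟩ := hpoly a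
  obtain ⟨g, hg⟩ := hpoly b
  exact ⟨f, g, by rw [hf, hg]⟩

lemma exists_eq_aeval_div_one (r : Polyradius 1) (x : GaussField k r) :
    ∃ p q : Polynomial k, x = Polynomial.aeval (T r 0) p / Polynomial.aeval (T r 0) q :=
  exists_eq_aeval_div r (fun i => i.elim0) x

/-- With no variables left in the tail, the coefficients are constants, whose Gauss norm is their
absolute value. -/
lemma isNormOrthogonal_pow_one (r : Polyradius 1) :
    IsNormOrthogonal k fun i : ℕ => (T r 0 ^ i : GaussField k r) := by
  intro s c j hj
  have := gaussNNNorm_mul_le_norm_sum r s (fun i => C (c i)) hj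
  rw [gaussNNNorm_C] at this
  simpa [Algebra.smul_def, IsScalarTower.algebraMap_apply k (MvPolynomial (Fin 1) k)
    (GaussField k r), MvPolynomial.algebraMap_eq] using this

lemma toAlgHom_comp_rename_injective (k : Type*) [NormedField k] [IsUltrametricDist k]
    (r : Polyradius (n + 1)) :
    Function.Injective ((IsScalarTower.toAlgHom k (MvPolynomial (Fin (n + 1)) k)
      (GaussField k r)).comp (rename (Fin.succ : Fin n → Fin (n + 1)))) :=
  (IsFractionRing.injective (MvPolynomial (Fin (n + 1)) k) (GaussField k r)).comp
    (rename_injective _ (Fin.succ_injective n))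

/-- The inclusion of the field of rational functions in all variables but the first. -/
def tailHom (k : Type*) [NormedField k] [IsUltrametricDist k] (r : Polyradius (n + 1)) :
    GaussField k r.tail →ₐ[k] GaussField k r :=
  IsFractionRing.liftAlgHom (toAlgHom_comp_rename_injective k r)

lemma tailHom_algebraMap (r : Polyradius (n + 1)) (q : MvPolynomial (Fin n) k) :
    tailHom k r (algebraMap _ _ q) = algebraMap _ _ (rename Fin.succ q) := by
  exact IsFractionRing.lift_algebraMap (toAlgHom_comp_rename_injective k r) q

lemma norm_tailHom (r : Polyradius (n + 1)) (x : GaussField k r.tail) :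
    ‖tailHom k r x‖ = ‖x‖ := by
  obtain ⟨a, b, _, rfl⟩ := IsFractionRing.div_surjective (A := MvPolynomial (Fin n) k) x
  rw [map_div₀, tailHom_algebraMap, tailHom_algebraMap, norm_div, norm_div,
    gaussNNNorm_rename_succ, gaussNNNorm_rename_succ]

/-- `k(T / r)` as a normed algebra over the field of rational functions in all variables but the
first. -/
@[reducible] def tailNormedAlgebra (k : Type*) [NormedField k] [IsUltrametricDist k]
    (r : Polyradius (n + 1)) : NormedAlgebra (GaussField k r.tail) (GaussField k r) where
  toAlgebra := (tailHom k r).toRingHom.toAlgebra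
  norm_smul_le a x := by
    change ‖tailHom k r a * x‖ ≤ _
    rw [norm_mul, norm_tailHom]

lemma tail_isScalarTower (r : Polyradius (n + 1)) :
    letI := tailNormedAlgebra k r
    IsScalarTower k (GaussField k r.tail) (GaussField k r) :=
  letI := tailNormedAlgebra k r
  IsScalarTower.of_algebraMap_eq fun x => ((tailHom k r).commutes x).symm

/-- A common denominator `q` reduces rational coefficients to polynomial ones; its norm factors out
because the norm is multiplicative. -/
lemma isNormOrthogonal_pow_tail (r : Polyradius (n + 1)) :
    letI := tailNormedAlgebra k r
    IsNormOrthogonal (GaussField k r.tail) fun i : ℕ => (T r 0 ^ i : GaussField k r) := by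
  let _ := tailNormedAlgebra k r
  intro s c j hj
  obtain ⟨⟨q, hq⟩, hint⟩ := IsLocalization.exist_integer_multiples
    (nonZeroDivisors (MvPolynomial (Fin n) k)) s c
  have hP : ∀ i, ∃ P : MvPolynomial (Fin n) k, i ∈ s →
      algebraMap _ (GaussField k r.tail) P = algebraMap _ _ q * c i := fun i => by
    by_cases hi : i ∈ s
    · obtain ⟨P, hP⟩ := hint i hi
      exact ⟨P, fun _ => hP.trans (Algebra.smul_def q (c i))⟩
    · exact ⟨0, fun h => absurd h hi⟩
  choose P hP using hP
  have h := gaussNNNorm_mul_le_norm_sum r s P hj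
  have e : ∑ i ∈ s, algebraMap (MvPolynomial (Fin (n + 1)) k) (GaussField k r)
      (rename Fin.succ (P i)) * T r 0 ^ i =
      tailHom k r (algebraMap _ _ q) * ∑ i ∈ s, c i • (T r 0 ^ i : GaussField k r) := by
    rw [Finset.mul_sum]
    refine Finset.sum_congr rfl fun i hi => ?_
    rw [← tailHom_algebraMap, hP i hi, map_mul, mul_assoc]
    rfl
  have hq0 : 0 < ‖algebraMap _ (GaussField k r.tail) q‖ := norm_pos_iff.2
    (IsFractionRing.to_map_ne_zero_of_mem_nonZeroDivisors hq)
  rw [e, norm_mul, norm_tailHom, ← norm_algebraMap_polynomial, hP j hj, norm_mul,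
    mul_assoc] at h
  exact le_of_mul_le_mul_left h hq0

/-- `k(T / r)` has an orthogonal total family over `k`, for every polyradius `r`. -/
theorem exists_isOrthogonalTotal {k : Type u} [NormedField k] [IsUltrametricDist k] (n : ℕ)
    (r : Polyradius n) :
    ∃ (J : Type u) (v : J → GaussField k r), IsOrthogonalTotal k v := by
  induction n with
  | zero =>
    -- Without variables the field is `k` itself, with basis `1`.
    refine ⟨PUnit, fun _ => 1, fun _ => one_ne_zero, ?_, fun x => subset_closure ?_⟩
    · rintro s c ⟨⟩ hj
      rw [Finset.eq_singleton_iff_unique_mem.2 ⟨hj, fun _ _ => rfl⟩, Finset.sum_singleton,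
        norm_smul]
    · obtain ⟨a, b, _, rfl⟩ := IsFractionRing.div_surjective (A := MvPolynomial (Fin 0) k) x
      rw [eq_C_of_isEmpty a, eq_C_of_isEmpty b, ← MvPolynomial.algebraMap_eq,
        ← IsScalarTower.algebraMap_apply, ← IsScalarTower.algebraMap_apply, ← map_div₀,
        Algebra.algebraMap_eq_smul_one]
      exact Submodule.smul_mem _ _ (Submodule.subset_span ⟨PUnit.unit, rfl⟩)
  | succ n ih =>
    obtain ⟨I, v, hv⟩ := ih r.tail
    let _ := tailNormedAlgebra k r
    have := tail_isScalarTower (k := k) r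
    -- The one-variable theorem is applied with the field in the other variables as base and `T₀` as
    -- variable.
    obtain ⟨J, w, hw⟩ := exists_isOrthogonalTotal_of_pow (T_ne_zero r 0)
      (isNormOrthogonal_pow_tail r) (exists_eq_aeval_div (k := k) r fun i =>
        ⟨T r.tail i, (tailHom_algebraMap r _).trans (by rw [rename_X, T])⟩)
    exact ⟨J × I, _, hv.tower hw⟩

end GaussField

end GaussFieldOneVariable

end

/-! ### The three statements, transported to the completion. -/

theorem mainTheorem10 {k : Type u} [NormedField k] [IsUltrametricDist k] [CompleteSpace k] :
    -- For every polyradius `r`, the completion of `k(T / r)` has an orthogonal Schauder basis.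
    (∀ (n : ℕ) (r : Polyradius n),
      ∃ (J : Type u) (v : J → UniformSpace.Completion (GaussField k r)),
        IsOrthogonalSchauderBasis k v) ∧
    -- One variable, no positive power of `r` in the value group of `k`: the monomials.
    (∀ r : Polyradius 1, (∀ m : ℕ, 0 < m → ∀ a : k, ‖a‖₊ ≠ (r 0 : ℝ≥0) ^ m) →
      IsOrthogonalSchauderBasis k fun i : ℤ =>
        ((GaussField.T r 0 ^ i : GaussField k r) :
          UniformSpace.Completion (GaussField k r))) ∧
    -- One variable, `r` of order `N` modulo the value group of `k`, `|c| = r ^ N`: the products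
    -- of `T ^ a`, `0 ≤ a < N`, with the powers and partial fractions of `S = c⁻¹ T ^ N`.
    (∀ (r : Polyradius 1) (N : ℕ) (c : k), 0 < N → ‖c‖₊ = (r 0 : ℝ≥0) ^ N →
      (∀ m : ℕ, 0 < m → m < N → ∀ a : k, ‖a‖₊ ≠ (r 0 : ℝ≥0) ^ m) →
      ∀ Ps : Set (Polynomial (integerRing k)), IsIrreducibleLift Ps →
      IsOrthogonalSchauderBasis k
        fun j : Fin N × (ℕ ⊕ (Σ P : Ps, Fin P.1.natDegree × ℕ)) =>
          ((GaussField.T r 0 ^ (j.1 : ℕ) *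
            partialFractionFamily Ps (c⁻¹ • GaussField.T r 0 ^ N) j.2 : GaussField k r) :
              UniformSpace.Completion (GaussField k r))) := by
  refine ⟨fun n r => ?_, fun r h => ?_, fun r N c hN hc h Ps hPs => ?_⟩
  · obtain ⟨J, v, hv⟩ := GaussField.exists_isOrthogonalTotal (k := k) n r
    exact ⟨J, _, hv.isOrthogonalSchauderBasis⟩
  · have hv := isOrthogonalTotal_zpow (k := k) (GaussField.T_ne_zero r 0)
      (fun m hm a ha => by
        rw [GaussField.norm_T] at ha
        exact h m hm a (NNReal.eq (by simpa using ha)))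
      (GaussField.exists_eq_aeval_div_one r)
    exact hv.isOrthogonalSchauderBasis
  · have hv := isOrthogonalTotal_pow_mul_partialFractionFamily (k := k) (GaussField.T_ne_zero r 0)
      (GaussField.isNormOrthogonal_pow_one r) (GaussField.exists_eq_aeval_div_one r)
      hN (c := c) (by
        rw [GaussField.norm_T, ← coe_nnnorm, hc, NNReal.coe_pow])
      (fun m hm hlt a ha => by
        rw [GaussField.norm_T] at ha
        exact h m hm hlt a (NNReal.eq (by simpa using ha))) hPs
    exact hv.isOrthogonalSchauderBasis
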